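/- Let $C$ be the ellipse $\frac{x^2}{a^2}+\frac{y^2}{b^2}=1$ with $0<b\le a$, viewed as the boundary of a billiard table, and let $O$ be a point inside $C$ that is not a focus $(\pm\sqrt{a^2-b^2},0)$ (so $O$ is not the centre if $C$ is a circle). The conics confocal to $C$ are $C_\lambda:\ \frac{x^2}{a^2-\lambda}+\frac{y^2}{b^2-\lambda}=1$, ellipses for $\lambda<b^2$ and hyperbolas for $b^2<\lambda<a^2$. Let $E$ and $H$ be the confocal ellipse and the confocal hyperbola through $O$, with the following conventions in the degenerate cases: if $O$ lies on the open segment between the foci, the role of $E$ is played by the major axis $y=0$; if $O$ lies on the minor axis $x=0$, the role of $H$ is played by the minor axis; if $O$ lies on the major axis, outside the segment between the foci, the role of $H$ is played by the major axis; if $C$ is a circle, the role of $H$ is played by the line through $O$ and the centre. (The tangent line of an axis, at each of its points, is the axis itself.) Then $E$ and $H$ exist and are unique, and exactly two rays emanating from $O$ are tangent to $E$ and exactly two others are tangent to $H$. For $n\ge 1$ and an angle $\theta$, let $\ell_n(\theta)$ be the line of the billiard trajectory that leaves $O$ in the direction $(\cos\theta,\sin\theta)$, after $n$ reflections off $C$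 (angle of incidence equal to angle of reflection). The $n$-th caustic by reflection from $O$ is the envelope $\Gamma_n$ of this family of lines, a smooth parametrized curve in $\mathbb{RP}^2$ whose tangent line at $\Gamma_n(\theta)$ is $\ell_n(\theta)$. A parametrized curve $\Gamma$ has a cusp at a parameter $\theta_0$ if, for some $m\ge2$, it has an $m$-cusp there: there is a diffeomorphism from a neighbourhood of the point $\Gamma(\theta_0)$ to a neighbourhood of the origin of the $(x,y)$-plane that takes the point to the origin and the branch of $\Gamma$ given by the parameters near $\theta_0$ to the curve $y^m=x^{m+1}$, parametrized, after a smooth change of parameter, by $(t^m,t^{m+1})$. Then, for every $n\ge1$ and for each of the four rays from $O$ tangent to $E$ or $H$, with direction angle $\theta$, the line $\ell_n(\theta)$ is again tangent to the same curve $E$ or $H$, the point of tangency (a point of $\mathbb{RP}^2$, possibly at infinity) is the point $\Gamma_n(\theta)$ of the $n$-th caustic, and $\Gamma_n$ has a cusp at $\theta$. -/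

import Mathlib

open scoped ContDiff Matrix Manifold Topology

noncomputable section

namespace EllipticBilliard

/-! The plane is `ℝ × ℝ`.  Points and lines of the real projective plane are given by nonzero
homogeneous coordinates in `Fin 3 → ℝ`: the affine point `(x, y)` is `![x, y, 1]`, and the line `ℓ`
consists of the points `P` with `ℓ ⬝ᵥ P = 0`. -/

/-- A ray (directed line), given by one of its points (first component) and its direction vector
(second component). -/
abbrev Ray := (ℝ × ℝ) × (ℝ × ℝ)

/-- The symmetric bilinear form of the ellipse `C : x² / a² + y² / b² = 1`. -/
def form (a b : ℝ) (v w : ℝ × ℝ) : ℝ := v.1 * w.1 / a ^ 2 + v.2 * w.2 / b ^ 2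

/-- `O` is one of the two foci `(± √(a² - b²), 0)` of the ellipse `C`, where `b ≤ a`
(the centre if `a = b`). -/
def IsFocus (a b : ℝ) (O : ℝ × ℝ) : Prop := O.1 ^ 2 = a ^ 2 - b ^ 2 ∧ O.2 = 0

/-! ### The billiard map -/

/-- For a ray `(q, v)` with `q` in the table: the largest root `t` of the quadratic equation
`form a b (q + t • v) (q + t • v) = 1`, that is, the time at which the ray leaves the table. -/
def exitTime (a b : ℝ) (r : Ray) : ℝ :=
  (-form a b r.1 r.2 + √(form a b r.1 r.2 ^ 2 + form a b r.2 r.2 * (1 - form a b r.1 r.1)))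
    / form a b r.2 r.2

/-- The point of `C` at which the ray hits `C`. -/
def exitPoint (a b : ℝ) (r : Ray) : ℝ × ℝ := r.1 + exitTime a b r • r.2

/-- A normal vector of `C` at the point `X` of `C`. -/
def normal (a b : ℝ) (X : ℝ × ℝ) : ℝ × ℝ := (X.1 / a ^ 2, X.2 / b ^ 2)

/-- The mirror image of the vector `v` in the line through the origin perpendicular to `N`. -/
def mirror (N v : ℝ × ℝ) : ℝ × ℝ :=
  v - (2 * (v.1 * N.1 + v.2 * N.2) / (N.1 ^ 2 + N.2 ^ 2)) • N

/-- The billiard transformation: the incoming ray is sent to the outgoing ray, which starts at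
the point where `C` is hit, the angle of reflection being equal to the angle of incidence. -/
def bounce (a b : ℝ) (r : Ray) : Ray :=
  (exitPoint a b r, mirror (normal a b (exitPoint a b r)) r.2)

/-- The ray that emanates from `O` in the direction of angle `θ`. -/
def pencil (O : ℝ × ℝ) (θ : ℝ) : Ray := (O, (Real.cos θ, Real.sin θ))

/-- The homogeneous coordinates of the (undirected) line that carries a ray. -/
def lineOf (r : Ray) : Fin 3 → ℝ :=
  ![r.2.2, -r.2.1, r.1.2 * r.2.1 - r.1.1 * r.2.2]

/-- The line of the ray that leaves `O` in the direction of angle `θ`, after `n` reflections. -/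
def reflectedLine (a b : ℝ) (O : ℝ × ℝ) (n : ℕ) (θ : ℝ) : Fin 3 → ℝ :=
  lineOf ((bounce a b)^[n] (pencil O θ))

/-! ### Envelopes and cusps -/

/-- `Γ` is the envelope of the family of lines `ℓ`: a smooth parametrized curve in the projective
plane such that `ℓ s` is, for every `s`, the line tangent to `Γ` at `Γ s`. -/
def IsEnvelope (ℓ Γ : ℝ → Fin 3 → ℝ) : Prop :=
  ContDiff ℝ ∞ Γ ∧ ∀ s, Γ s ≠ 0 ∧ ℓ s ⬝ᵥ Γ s = 0 ∧ ℓ s ⬝ᵥ deriv Γ s = 0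

/-- The `n`-th caustic by reflection from `O`.  An envelope `Γ` of `ℓ` satisfies `ℓ ⬝ᵥ Γ = 0` and
`ℓ' ⬝ᵥ Γ = 0`, so that, in homogeneous coordinates, it is the cross product of `ℓ` and `ℓ'`. -/
def caustic (a b : ℝ) (O : ℝ × ℝ) (n : ℕ) (θ : ℝ) : Fin 3 → ℝ :=
  crossProduct (reflectedLine a b O n θ) (deriv (reflectedLine a b O n) θ)

/-- The parametrized projective curve `Γ` has an `m`-cusp (`2 ≤ m`) at the parameter `s₀`.  In an
affine chart `[X : Y : W] ↦ (X / W, Y / W)` of the projective plane around the point `Γ s₀` (for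
some choice of projective coordinates `(X, Y, W) = A *ᵥ P`), there is a diffeomorphism `Φ` from a
neighbourhood of the point to a neighbourhood of the origin that takes the point to the origin and
the curve, near `s₀`, to the curve `y ^ m = x ^ (m + 1)`, that is, to `t ↦ (t ^ m, t ^ (m + 1))`,
where `t = τ s` is a local change of parameter. -/
def IsMCuspAt (m : ℕ) (Γ : ℝ → Fin 3 → ℝ) (s₀ : ℝ) : Prop :=
  2 ≤ m ∧ ∃ A : Matrix (Fin 3) (Fin 3) ℝ, A.det ≠ 0 ∧ (A *ᵥ Γ s₀) 2 ≠ 0 ∧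
    ∃ c : ℝ → ℝ × ℝ,
      (∀ s, c s = ((A *ᵥ Γ s) 0 / (A *ᵥ Γ s) 2, (A *ᵥ Γ s) 1 / (A *ᵥ Γ s) 2)) ∧
      ∃ (Φ : ℝ × ℝ → ℝ × ℝ) (τ : ℝ → ℝ),
        IsLocalDiffeomorphAt 𝓘(ℝ, ℝ × ℝ) 𝓘(ℝ, ℝ × ℝ) ∞ Φ (c s₀) ∧ Φ (c s₀) = 0 ∧
        IsLocalDiffeomorphAt 𝓘(ℝ) 𝓘(ℝ) ∞ τ s₀ ∧ τ s₀ = 0 ∧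
        ∀ᶠ s in 𝓝 s₀, Φ (c s) = (τ s ^ m, τ s ^ (m + 1))

/-- The curve has a cusp, that is, an `m`-cusp for some `m ≥ 2`. -/
def IsCuspAt (Γ : ℝ → Fin 3 → ℝ) (s₀ : ℝ) : Prop := ∃ m, IsMCuspAt m Γ s₀

/-! ### The confocal family -/

/-- The curves of the confocal family: the conic `Pᵀ Q P = 0` of a symmetric matrix `Q`,
and the line of homogeneous coordinates `L`. -/
inductive Curve where
  | conic (Q : Matrix (Fin 3) (Fin 3) ℝ)
  | line (L : Fin 3 → ℝ)

/-- The line `ℓ` is tangent to the curve at the point `P` of the projective plane.  The tangent at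
the point `P` of a conic is the polar `Q P`; a line is its own tangent at each of its points. -/
def IsTangentAt : Curve → (Fin 3 → ℝ) → (Fin 3 → ℝ) → Prop
  | .conic Q, ℓ, P => P ≠ 0 ∧ P ⬝ᵥ (Q *ᵥ P) = 0 ∧ ∃ k : ℝ, k ≠ 0 ∧ ℓ = k • (Q *ᵥ P)
  | .line L, ℓ, P => P ≠ 0 ∧ L ⬝ᵥ P = 0 ∧ ∃ k : ℝ, k ≠ 0 ∧ ℓ = k • L

/-- The confocal conic `x² / (a² - l) + y² / (b² - l) = 1`: an ellipse for `l < b²`,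
a hyperbola for `b² < l < a²`. -/
def confocalConic (a b l : ℝ) : Curve :=
  .conic (Matrix.diagonal ![1 / (a ^ 2 - l), 1 / (b ^ 2 - l), -1])

/-- The point `O` lies on the confocal conic with parameter `l`. -/
def OnConfocalConic (a b l : ℝ) (O : ℝ × ℝ) : Prop :=
  O.1 ^ 2 / (a ^ 2 - l) + O.2 ^ 2 / (b ^ 2 - l) = 1

/-- `K` is the confocal ellipse through `O`.  If `O` is on the open segment between the foci, where
the confocal ellipse degenerates, its role is played by the major axis `y = 0`. -/
def IsEllipseThrough (a b : ℝ) (O : ℝ × ℝ) (K : Curve) : Prop :=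
  (∃ l, l < b ^ 2 ∧ OnConfocalConic a b l O ∧ K = confocalConic a b l) ∨
  (O.2 = 0 ∧ O.1 ^ 2 < a ^ 2 - b ^ 2 ∧ K = .line ![0, 1, 0])

/-- `K` is the confocal hyperbola through `O`.  Its role is played by the minor axis `x = 0` if `O`
lies on it, by the major axis `y = 0` if `O` lies on it outside the segment between the foci, and,
if `C` is a circle, by the line through `O` and the centre. -/
def IsHyperbolaThrough (a b : ℝ) (O : ℝ × ℝ) (K : Curve) : Prop :=
  (∃ l, b ^ 2 < l ∧ l < a ^ 2 ∧ OnConfocalConic a b l O ∧ K = confocalConic a b l) ∨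
  (b < a ∧ O.1 = 0 ∧ K = .line ![1, 0, 0]) ∨
  (b < a ∧ O.2 = 0 ∧ a ^ 2 - b ^ 2 < O.1 ^ 2 ∧ K = .line ![0, 1, 0]) ∨
  (a = b ∧ K = .line ![O.2, -O.1, 0])

/-- The angles, in `[0, 2π)`, of the rays that emanate from `O` and are tangent to `K`. -/
def tangentAngles (O : ℝ × ℝ) (K : Curve) : Set ℝ :=
  {θ | θ ∈ Set.Ico 0 (2 * Real.pi) ∧ ∃ P, IsTangentAt K (lineOf (pencil O θ)) P}

end EllipticBilliard

end

open EllipticBilliard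

/-! Write the line with unit direction `(c, s)` as `l = (s, -c, w)`. Its envelope is `l × l'`, and a
simple zero of the determinant `det (l, l', l'')` gives a semicubical cusp (`isMCuspAt_two_of_det`).
So every cusp in question is a 2-cusp, and the task is to locate the simple zeros of this
determinant for the family after `n` reflections.

Two facts do this. First, `disc` is conserved by the billiard map (`Regular.disc_bounce`, the
Joachimsthal invariant); since `a² b² disc = a² s² + b² c² - w²`, its value names the confocal conic
tangent to the line. Second, one reflection subtracts from the determinant a nonnegative multiple of
`J'`, where `J = √disc` (`lineDet_reflect`). By conservation `J` is the same function of the angle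
for every `n`, and the determinant of the initial pencil is zero because its lines are concurrent.
Hence the `n`-th determinant is `-S J'` with `S > 0` once `n ≥ 1` (`exists_lineDet_ray_eq`), and
cusps occur at the nondegenerate critical points of `disc` along the pencil.

There `a² b² disc` is a quadratic form in `(cos θ, sin θ)`. It is not scalar because `O` is not a
focus, so its critical directions are its eigenvectors and are nondegenerate. Its characteristic
equation is the equation for the parameters of the confocal conics through `O`: the eigenvalues are
the parameters of `E` and `H`, and the eigenvectors are the tangent rays.

For the contact point, the conserved quantity keeps each reflected line tangent to the same conic.
Since its derivative vanishes at the critical angle, `l` and `l'` both pass through the pole of `l`,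
which is therefore the envelope point `l × l'`. Degenerate conics are axes, which the trajectory
never leaves. -/

/-! ### Analytic normal form of the semicubical cusp -/

/-- The inverse function theorem, with the local inverse cut down to an open set on which the map
and its inverse are both analytic. Analyticity at a point spreads to a neighbourhood, which provides
this set. -/
theorem ContDiffAt.isLocalDiffeomorphAt {E F : Type*} [NormedAddCommGroup E] [NormedSpace ℝ E]
    [NormedAddCommGroup F] [NormedSpace ℝ F] [CompleteSpace E] {f : E → F} {f' : E ≃L[ℝ] F} {x : E}
    (hf : ContDiffAt ℝ ω f x) (hf' : HasFDerivAt f (f' : E →L[ℝ] F) x) :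
    IsLocalDiffeomorphAt 𝓘(ℝ, E) 𝓘(ℝ, F) ∞ f x := by
  have hω : (ω : WithTop ℕ∞) ≠ 0 := by simp
  set e := hf.toOpenPartialHomeomorph f hf' hω with he
  have hxs : x ∈ e.source := hf.mem_toOpenPartialHomeomorph_source hf' hω
  have hef : (e : E → F) = f := rfl
  have hsymm : ContDiffAt ℝ ω e.symm (f x) := by
    apply e.contDiffAt_symm (f₀' := f') (e.map_source hxs)
    · rw [e.left_inv hxs]; exact hf'
    · rw [e.left_inv hxs]; exact hf
  let s : Set E := {y | ContDiffAt ℝ ω f y ∧ ContDiffAt ℝ ω e.symm (f y)}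
  have hs : s ∈ 𝓝 x := by
    have h1 := hf.eventually (by simp)
    have h2 := hf.continuousAt.eventually (hsymm.eventually (by simp))
    exact h1.and h2
  let e' := e.restr s
  have hsrc : e'.source = e.source ∩ interior s := e.restr_source s
  refine ⟨⟨e'.toPartialEquiv, e'.open_source, e'.open_target, ?_, ?_⟩, ?_, fun _ _ => rfl⟩
  · rw [contMDiffOn_iff_contDiffOn]
    intro y hy
    have hy' : y ∈ e'.source := hy
    rw [hsrc] at hy'
    exact ((interior_subset hy'.2).1.of_le le_top).contDiffWithinAt
  · rw [contMDiffOn_iff_contDiffOn]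
    intro y hy
    have hy' : e'.symm y ∈ e'.source := e'.map_target hy
    have hy2 : f (e'.symm y) = y := e'.right_inv hy
    rw [hsrc] at hy'
    have := (interior_subset hy'.2).2
    rw [hy2] at this
    exact (this.of_le le_top).contDiffWithinAt
  · change x ∈ e'.source
    rw [hsrc]
    exact ⟨hxs, mem_interior_iff_mem_nhds.2 hs⟩

/-- The sum of a convergent real power series is analytic at the origin. -/
theorem analyticAt_tsum_of_bound {c : ℕ → ℝ} {C r : ℝ} (hr : 0 < r)
    (hc : ∀ n, |c n| * r ^ n ≤ C) : AnalyticAt ℝ (fun x => ∑' n, c n * x ^ n) 0 := by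
  lift r to NNReal using hr.le
  have hrad : 0 < (FormalMultilinearSeries.ofScalars ℝ c).radius :=
    lt_of_lt_of_le (by exact_mod_cast hr)
      (FormalMultilinearSeries.le_radius_of_bound _ C (r := r) fun n => by simpa using hc n)
  have h := (FormalMultilinearSeries.hasFPowerSeriesOnBall _ hrad).analyticAt
  refine h.congr (Filter.Eventually.of_forall fun x => ?_)
  simp [FormalMultilinearSeries.sum, mul_comm]

/-- The decomposition of an analytic function into its even and odd parts. -/
theorem AnalyticAt.exists_even_odd {f : ℝ → ℝ} (hf : AnalyticAt ℝ f 0) :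
    ∃ g h : ℝ → ℝ, AnalyticAt ℝ g 0 ∧ AnalyticAt ℝ h 0 ∧ g 0 = f 0 ∧
      ∀ᶠ t in 𝓝 0, f t = g (t ^ 2) + t * h (t ^ 2) := by
  obtain ⟨p, ρ, hp⟩ := hf
  obtain ⟨r, hr0, hrρ⟩ := ENNReal.lt_iff_exists_nnreal_btwn.1 (hp.r_pos)
  have hr : 0 < (r : ℝ) := by exact_mod_cast hr0
  obtain ⟨C, hC0, hC⟩ := p.norm_mul_pow_le_of_lt_radius (lt_of_lt_of_le hrρ hp.r_le)
  have hb : ∀ n, |p.coeff n| * (r : ℝ) ^ n ≤ C := fun n => by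
    simpa using hC n
  set g : ℝ → ℝ := fun x => ∑' n, p.coeff (2 * n) * x ^ n
  set h : ℝ → ℝ := fun x => ∑' n, p.coeff (2 * n + 1) * x ^ n
  have key : ∀ t : ℝ, |t| < r → f t = g (t ^ 2) + t * h (t ^ 2) := by
    intro t ht
    have hsum : HasSum (fun n => p.coeff n * t ^ n) (f t) := by
      have := hp.hasSum (y := t) (by
        refine lt_of_lt_of_le ?_ hrρ.le
        rw [edist_zero_right, enorm_eq_nnnorm]
        exact_mod_cast ht)
      simpa [mul_comm] using this
    have hs2 := hsum.summable
    have he : Summable (fun n => p.coeff (2 * n) * t ^ (2 * n)) :=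
      hs2.comp_injective (i := fun n : ℕ => 2 * n) (mul_right_injective₀ two_ne_zero)
    have ho : Summable (fun n => p.coeff (2 * n + 1) * t ^ (2 * n + 1)) :=
      hs2.comp_injective (i := fun n : ℕ => 2 * n + 1)
        ((add_left_injective 1).comp (mul_right_injective₀ two_ne_zero))
    rw [← hsum.tsum_eq, ← tsum_even_add_odd (f := fun n => p.coeff n * t ^ n) he ho]
    simp only [g, h, ← tsum_mul_left]
    congr 1
    · exact tsum_congr fun n => by rw [pow_mul]
    · exact tsum_congr fun n => by rw [pow_succ, pow_mul]; ring
  refine ⟨g, h, ?_, ?_, ?_, ?_⟩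
  · refine analyticAt_tsum_of_bound (C := C) (r := (r : ℝ) ^ 2) (by positivity) fun n => ?_
    rw [← pow_mul]; exact hb _
  · refine analyticAt_tsum_of_bound (C := C / r) (r := (r : ℝ) ^ 2) (by positivity) fun n => ?_
    rw [← pow_mul, le_div_iff₀ hr, mul_assoc, ← pow_succ]; exact hb _
  · have := key 0 (by simpa using hr)
    simpa using this.symm
  · have : {t : ℝ | |t| < r} ∈ 𝓝 (0 : ℝ) :=
      (isOpen_lt continuous_abs continuous_const).mem_nhds (by simpa using hr)
    filter_upwards [this] with t ht using key t ht

/-- A plane curve `(t ^ 2 A, t ^ 3 B)` with `A`, `B` analytic and nonzero is, up to a change of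
coordinates and of parameter, the semicubical cusp. -/
theorem exists_semicubical_normal_form {x y A B : ℝ → ℝ} {s₀ : ℝ} (hA : AnalyticAt ℝ A s₀)
    (hB : AnalyticAt ℝ B s₀) (hA0 : A s₀ ≠ 0) (hB0 : B s₀ ≠ 0)
    (hx : ∀ᶠ s in 𝓝 s₀, x s = (s - s₀) ^ 2 * A s) (hy : ∀ᶠ s in 𝓝 s₀, y s = (s - s₀) ^ 3 * B s) :
    ∃ (Φ : ℝ × ℝ → ℝ × ℝ) (τ : ℝ → ℝ),
      IsLocalDiffeomorphAt 𝓘(ℝ, ℝ × ℝ) 𝓘(ℝ, ℝ × ℝ) ∞ Φ 0 ∧ Φ 0 = 0 ∧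
      IsLocalDiffeomorphAt 𝓘(ℝ) 𝓘(ℝ) ∞ τ s₀ ∧ τ s₀ = 0 ∧
      ∀ᶠ s in 𝓝 s₀, Φ (x s, y s) = (τ s ^ 2, τ s ^ 3) := by
  -- `ε` is the sign of `A s₀`, so that `ε A` has a real square root.
  obtain ⟨ε, hε, hεA⟩ : ∃ ε : ℝ, ε * ε = 1 ∧ 0 < ε * A s₀ := by
    rcases lt_or_gt_of_ne hA0 with h | h
    · exact ⟨-1, by norm_num, by linarith⟩
    · exact ⟨1, by norm_num, by linarith⟩
  have hε0 : ε ≠ 0 := fun h => by simp [h] at hε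
  set R : ℝ → ℝ := fun s => √(ε * A s) with hR
  have hRa : ContDiffAt ℝ ω R s₀ := (contDiffAt_const.mul hA.contDiffAt).sqrt hεA.ne'
  have hR0 : R s₀ ≠ 0 := (Real.sqrt_pos.2 hεA).ne'
  have hRpos : ∀ᶠ s in 𝓝 s₀, 0 < ε * A s :=
    (continuousAt_const.mul hA.continuousAt).eventually (lt_mem_nhds hεA)
  -- The new parameter satisfies `τ² = ε x` exactly.
  set τ : ℝ → ℝ := fun s => (s - s₀) * R s with hτ
  have hτa : ContDiffAt ℝ ω τ s₀ := (contDiffAt_id.sub contDiffAt_const).mul hRa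
  have hτ0 : τ s₀ = 0 := by simp [hτ]
  have hτd : HasDerivAt τ (R s₀) s₀ := by
    have := ((hasDerivAt_id s₀).sub_const s₀).mul (hRa.differentiableAt (by simp)).hasDerivAt
    simp only [id, sub_self, one_mul, zero_mul, add_zero] at this
    exact this
  have hτe := hτd.hasFDerivAt_equiv hR0
  have hω : (ω : WithTop ℕ∞) ≠ 0 := by simp
  set inv := hτa.localInverse hτe hω
  have hinv : ContDiffAt ℝ ω inv 0 := by
    have := hτa.to_localInverse hτe hω
    rwa [hτ0] at this
  have hinv0 : inv 0 = s₀ := by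
    have := hτa.localInverse_apply_image hτe hω
    rwa [hτ0] at this
  have hleft : ∀ᶠ s in 𝓝 s₀, inv (τ s) = s :=
    (hτa.hasStrictFDerivAt' hτe hω).eventually_left_inverse
  -- In the parameter `τ` the second coordinate is `y = τ³ Bt(τ)`.
  set Bt : ℝ → ℝ := fun u => B (inv u) / R (inv u) ^ 3 with hBt
  have hBta : AnalyticAt ℝ Bt 0 := by
    have h1 : ContDiffAt ℝ ω (fun s => B s / R s ^ 3) (inv 0) := by
      rw [hinv0]
      exact hB.contDiffAt.div (hRa.pow 3) (pow_ne_zero 3 hR0)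
    exact (h1.comp (0 : ℝ) hinv).analyticAt
  obtain ⟨g, h, hg, hh, hg0, hgh⟩ := hBta.exists_even_odd
  have hBt0 : Bt 0 ≠ 0 := by
    simp only [hBt, hinv0]
    exact div_ne_zero hB0 (pow_ne_zero 3 hR0)
  rw [← hg0] at hBt0
  -- With `X = ε x = τ²`, the splitting of `Bt` gives `y = τ³ g(X) + X² h(X)`. The even term is a
  -- function of `X` alone and is subtracted; division by `g(X)` then leaves `τ³`.
  set Φ : ℝ × ℝ → ℝ × ℝ :=
    fun p => (ε * p.1, (p.2 - (ε * p.1) ^ 2 * h (ε * p.1)) / g (ε * p.1)) with hΦ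
  have hgt : ∀ᶠ s in 𝓝 s₀, g (τ s ^ 2) ≠ 0 := by
    have hc : ContinuousAt (fun s => τ s ^ 2) s₀ := hτa.continuousAt.pow 2
    have hc2 : ContinuousAt (fun s => g (τ s ^ 2)) s₀ := by
      refine ContinuousAt.comp (f := fun s => τ s ^ 2) (g := g) ?_ hc
      simpa [hτ0] using hg.continuousAt
    refine hc2.eventually_ne ?_
    simpa [hτ0] using hBt0
  have hghτ : ∀ᶠ s in 𝓝 s₀, Bt (τ s) = g (τ s ^ 2) + τ s * h (τ s ^ 2) := by
    have hc := hτa.continuousAt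
    unfold ContinuousAt at hc
    rw [hτ0] at hc
    exact hc.eventually hgh
  refine ⟨Φ, τ, ?_, by simp [hΦ], ?_, hτ0, ?_⟩
  · have h1 : ContDiffAt ℝ ω (fun p : ℝ × ℝ => ε * p.1) 0 := contDiffAt_const.mul contDiffAt_fst
    have hg1 : ContDiffAt ℝ ω (fun p : ℝ × ℝ => g (ε * p.1)) 0 := by
      refine ContDiffAt.comp (g := g) (f := fun p : ℝ × ℝ => ε * p.1) 0 ?_ h1
      simpa using hg.contDiffAt
    have hh1 : ContDiffAt ℝ ω (fun p : ℝ × ℝ => h (ε * p.1)) 0 := by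
      refine ContDiffAt.comp (g := h) (f := fun p : ℝ × ℝ => ε * p.1) 0 ?_ h1
      simpa using hh.contDiffAt
    have hΦa : ContDiffAt ℝ ω Φ 0 :=
      h1.prodMk ((contDiffAt_snd.sub ((h1.pow 2).mul hh1)).div hg1 (by simpa using hBt0))
    let L : (ℝ × ℝ) ≃L[ℝ] (ℝ × ℝ) :=
      (ContinuousLinearEquiv.unitsEquivAut ℝ (Units.mk0 ε hε0)).prodCongr
        (ContinuousLinearEquiv.unitsEquivAut ℝ (Units.mk0 (g 0)⁻¹ (inv_ne_zero hBt0)))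
    refine hΦa.isLocalDiffeomorphAt (f' := L) ?_
    have d1 : HasFDerivAt (fun p : ℝ × ℝ => ε * p.1) (ε • ContinuousLinearMap.fst ℝ ℝ ℝ) 0 :=
      hasFDerivAt_fst.const_mul ε
    have d2 := (hasFDerivAt_snd (𝕜 := ℝ) (E := ℝ) (F := ℝ) (p := 0)).sub
      ((d1.pow 2).mul (hh1.differentiableAt hω).hasFDerivAt)
    have hg2 : ContDiffAt ℝ ω (fun p : ℝ × ℝ => (g (ε * p.1))⁻¹) 0 :=
      hg1.inv (by simpa using hBt0)
    have d3 := d2.mul (hg2.differentiableAt hω).hasFDerivAt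
    refine (d1.prodMk d3).congr_fderiv ?_
    ext <;> simp [L]
  · exact hτa.isLocalDiffeomorphAt hτe
  · filter_upwards [hx, hy, hRpos, hleft, hgt, hghτ] with s hx hy hRp hl hg0 hgh
    have hR2 : R s ^ 2 = ε * A s := Real.sq_sqrt hRp.le
    have hRs : R s ≠ 0 := (Real.sqrt_pos.2 hRp).ne'
    have hx1 : ε * x s = τ s ^ 2 := by
      rw [hx, hτ, mul_pow, hR2]; ring
    have hy1 : y s = τ s ^ 3 * (g (τ s ^ 2) + τ s * h (τ s ^ 2)) := by
      rw [← hgh, hy]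
      simp only [hBt, hl]
      simp only [hτ]
      field_simp
    simp only [hΦ, hx1, hy1]
    ext
    · rfl
    · field_simp
      ring

/-- Division of an analytic function by the power of the variable given by its order. -/
theorem AnalyticAt.exists_eq_sq_mul {f : ℝ → ℝ} {s₀ : ℝ} (hf : AnalyticAt ℝ f s₀) (h0 : f s₀ = 0)
    (h1 : deriv f s₀ = 0) (h2 : deriv (deriv f) s₀ ≠ 0) :
    ∃ g, AnalyticAt ℝ g s₀ ∧ g s₀ ≠ 0 ∧ ∀ᶠ s in 𝓝 s₀, f s = (s - s₀) ^ 2 * g s := by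
  refine (hf.analyticOrderAt_eq_natCast (n := 2)).1
    ((analyticOrderAt_eq_nat_iff_iteratedDeriv_eq_zero hf).2 ⟨?_, ?_⟩)
  · intro k hk
    interval_cases k
    · simpa using h0
    · simpa using h1
  · simpa [iteratedDeriv_succ, iteratedDeriv_zero] using h2

theorem AnalyticAt.exists_eq_cube_mul {f : ℝ → ℝ} {s₀ : ℝ} (hf : AnalyticAt ℝ f s₀) (h0 : f s₀ = 0)
    (h1 : deriv f s₀ = 0) (h2 : deriv (deriv f) s₀ = 0) (h3 : deriv (deriv (deriv f)) s₀ ≠ 0) :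
    ∃ g, AnalyticAt ℝ g s₀ ∧ g s₀ ≠ 0 ∧ ∀ᶠ s in 𝓝 s₀, f s = (s - s₀) ^ 3 * g s := by
  refine (hf.analyticOrderAt_eq_natCast (n := 3)).1
    ((analyticOrderAt_eq_nat_iff_iteratedDeriv_eq_zero hf).2 ⟨?_, ?_⟩)
  · intro k hk
    interval_cases k
    · simpa using h0
    · simpa using h1
    · simpa [iteratedDeriv_succ, iteratedDeriv_zero] using h2
  · simpa [iteratedDeriv_succ, iteratedDeriv_zero] using h3

/-! ### Cusps of envelopes of lines -/

theorem HasDerivAt.dotProduct_cross {f g : ℝ → Fin 3 → ℝ} {f' g' : Fin 3 → ℝ} {s : ℝ}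
    (hf : HasDerivAt f f' s) (hg : HasDerivAt g g' s) (r : Fin 3 → ℝ) :
    HasDerivAt (fun s => r ⬝ᵥ crossProduct (f s) (g s))
      (r ⬝ᵥ crossProduct f' (g s) + r ⬝ᵥ crossProduct (f s) g') s := by
  rw [hasDerivAt_pi] at hf hg
  simp only [cross_apply, dotProduct, Fin.sum_univ_three, Matrix.cons_val_zero,
    Matrix.cons_val_one, Matrix.cons_val]
  have h1 := ((((hf 1).mul (hg 2)).sub ((hf 2).mul (hg 1))).const_mul (r 0))
  have h2 := ((((hf 2).mul (hg 0)).sub ((hf 0).mul (hg 2))).const_mul (r 1))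
  have h3 := ((((hf 0).mul (hg 1)).sub ((hf 1).mul (hg 0))).const_mul (r 2))
  refine ((h1.add h2).add h3).congr_deriv ?_
  ring

theorem ContDiff.deriv_omega {F : Type*} [NormedAddCommGroup F] [NormedSpace ℝ F] {f : ℝ → F}
    (hf : ContDiff ℝ ω f) : ContDiff ℝ ω (deriv f) :=
  (contDiff_succ_iff_deriv (n := ω).1 hf).2.2

theorem ContDiff.hasDerivAt_omega {F : Type*} [NormedAddCommGroup F] [NormedSpace ℝ F] {f : ℝ → F}
    (hf : ContDiff ℝ ω f) (s : ℝ) : HasDerivAt f (deriv f s) s :=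
  (hf.differentiable (by simp) s).hasDerivAt

theorem ContDiff.dotProduct_cross {f g : ℝ → Fin 3 → ℝ} (hf : ContDiff ℝ ω f)
    (hg : ContDiff ℝ ω g) (r : Fin 3 → ℝ) :
    ContDiff ℝ ω (fun s => r ⬝ᵥ crossProduct (f s) (g s)) := by
  rw [contDiff_pi] at hf hg
  simp only [cross_apply, dotProduct, Fin.sum_univ_three, Matrix.cons_val_zero,
    Matrix.cons_val_one, Matrix.cons_val]
  have f0 := hf 0
  have f1 := hf 1
  have f2 := hf 2
  have g0 := hg 0
  have g1 := hg 1
  have g2 := hg 2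
  fun_prop

/-- The envelope of a family of lines has a semicubical cusp at the simple zeros of the determinant
of the lines and their first two derivatives. -/
theorem isMCuspAt_two_of_det {l : ℝ → Fin 3 → ℝ} (hl : ContDiff ℝ ω l) {s₀ : ℝ}
    (h2 : l s₀ ⬝ᵥ crossProduct (deriv l s₀) (deriv (deriv l) s₀) = 0)
    (h3 : l s₀ ⬝ᵥ crossProduct (deriv l s₀) (deriv (deriv (deriv l)) s₀) ≠ 0) :
    IsMCuspAt 2 (fun s => crossProduct (l s) (deriv l s)) s₀ := by
  have hl1 := hl.deriv_omega
  have hl2 := hl1.deriv_omega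
  have hl3 := hl2.deriv_omega
  set l0 := l s₀ with e0
  set l1 := deriv l s₀ with e1
  set l2 := deriv (deriv l) s₀ with e2
  set l3 := deriv (deriv (deriv l)) s₀ with e3
  let p : (Fin 3 → ℝ) → ℝ → ℝ := fun r s => r ⬝ᵥ crossProduct (l s) (deriv l s)
  have hp : ∀ r, AnalyticAt ℝ (p r) s₀ := fun r =>
    (hl.dotProduct_cross hl1 r).contDiffAt.analyticAt
  have d1 : ∀ r, deriv (p r) = fun s => r ⬝ᵥ crossProduct (l s) (deriv (deriv l) s) := fun r =>
    funext fun s => by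
      rw [((hl.hasDerivAt_omega s).dotProduct_cross (hl1.hasDerivAt_omega s) r).deriv]
      simp
  have d2 : ∀ r, deriv (deriv (p r)) = fun s => r ⬝ᵥ crossProduct (deriv l s) (deriv (deriv l) s) +
      r ⬝ᵥ crossProduct (l s) (deriv (deriv (deriv l)) s) := fun r =>
    funext fun s => by
      rw [d1, ((hl.hasDerivAt_omega s).dotProduct_cross (hl2.hasDerivAt_omega s) r).deriv]
  have d3 : ∀ r, deriv (deriv (deriv (p r))) s₀ = 2 * (r ⬝ᵥ crossProduct l1 l3) +
      r ⬝ᵥ crossProduct l0 (deriv (deriv (deriv (deriv l))) s₀) := fun r => by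
    rw [d2]
    refine (((hl1.hasDerivAt_omega s₀).dotProduct_cross (hl2.hasDerivAt_omega s₀) r).add
      ((hl.hasDerivAt_omega s₀).dotProduct_cross (hl3.hasDerivAt_omega s₀) r)).deriv.trans ?_
    simp only [cross_self, dotProduct_zero, ← e0, ← e1, ← e3]
    ring
  have hperm : l1 ⬝ᵥ crossProduct l0 l3 = - (l0 ⬝ᵥ crossProduct l1 l3) := by
    simp only [cross_apply, dotProduct, Fin.sum_univ_three, Matrix.cons_val_zero,
      Matrix.cons_val_one, Matrix.cons_val]
    ring
  have hperm2 : l1 ⬝ᵥ crossProduct l0 l2 = - (l0 ⬝ᵥ crossProduct l1 l2) := by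
    simp only [cross_apply, dotProduct, Fin.sum_univ_three, Matrix.cons_val_zero,
      Matrix.cons_val_one, Matrix.cons_val]
    ring
  have hperm3 : l3 ⬝ᵥ crossProduct l0 l1 = l0 ⬝ᵥ crossProduct l1 l3 := by
    simp only [cross_apply, dotProduct, Fin.sum_univ_three, Matrix.cons_val_zero,
      Matrix.cons_val_one, Matrix.cons_val]
    ring
  -- The rows `l', l, l'''` at `s₀` form a basis by `h3`. Paired with `l × l'` they give functions
  -- vanishing to order exactly 2, 3 and 0: the leading derivatives are `-det`, `2 det` and `det`,
  -- where `det = det (l, l', l''')`.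
  obtain ⟨A, hA, hA0, hxA⟩ := (hp l1).exists_eq_sq_mul (by simp [p, ← e0, ← e1])
    (by rw [d1]; dsimp only; rw [← e0, ← e2, hperm2, h2, neg_zero])
    (by rw [d2]; dsimp only; rw [← e0, ← e1, ← e2, ← e3, hperm]; simpa using h3)
  obtain ⟨B, hB, hB0, hyB⟩ := (hp l0).exists_eq_cube_mul (by simp [p, ← e0, ← e1])
    (by rw [d1]; dsimp only; simp [← e0]) (by rw [d2]; dsimp only; simp [← e0, ← e1, ← e2, h2])
    (by rw [d3]; simpa using h3)
  have hW : p l3 s₀ ≠ 0 := by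
    simp only [p, ← e0, ← e1, hperm3]
    exact h3
  obtain ⟨Φ, τ, hΦ, hΦ0, hτ, hτ0, hev⟩ := exists_semicubical_normal_form
    (x := fun s => p l1 s / p l3 s) (y := fun s => p l0 s / p l3 s)
    (hA.div (hp l3) hW) (hB.div (hp l3) hW) (div_ne_zero hA0 hW) (div_ne_zero hB0 hW)
    (hxA.mono fun s h => by dsimp only [Pi.div_apply]; rw [h, mul_div_assoc])
    (hyB.mono fun s h => by dsimp only [Pi.div_apply]; rw [h, mul_div_assoc])
  have hc0 : ((p l1 s₀ / p l3 s₀, p l0 s₀ / p l3 s₀) : ℝ × ℝ) = 0 := by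
    simp [p, ← e0, ← e1]
  refine ⟨le_rfl, Matrix.of ![l1, l0, l3], ?_, hW, fun s => (p l1 s / p l3 s, p l0 s / p l3 s),
    fun s => rfl, Φ, τ, ?_, ?_, hτ, hτ0, hev⟩
  · have : (Matrix.of ![l1, l0, l3]).det = - (l0 ⬝ᵥ crossProduct l1 l3) := by
      rw [Matrix.det_fin_three]
      simp only [cross_apply, dotProduct, Fin.sum_univ_three, Matrix.cons_val_zero,
        Matrix.cons_val_one, Matrix.cons_val, Matrix.of_apply]
      ring
    rw [this]
    exact neg_ne_zero.2 h3
  · dsimp only; rw [hc0]; exact hΦ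
  · dsimp only; rw [hc0]; exact hΦ0

/-! ### Families of lines reflected in an ellipse -/

noncomputable section

/-- The angular velocity of a parametrized curve `(c, s)` in the unit circle. -/
def angVel (c s : ℝ → ℝ) (t : ℝ) : ℝ := c t * deriv s t - s t * deriv c t

theorem contDiff_angVel {c s : ℝ → ℝ} (hc : ContDiff ℝ ω c) (hs : ContDiff ℝ ω s) :
    ContDiff ℝ ω (angVel c s) :=
  (hc.mul hs.deriv_omega).sub (hs.mul hc.deriv_omega)

/-- The derivative of a unit vector is orthogonal to it, hence `angVel` times its quarter turn. -/
theorem hasDerivAt_of_unit {c s : ℝ → ℝ} (hc : ContDiff ℝ ω c) (hs : ContDiff ℝ ω s)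
    (h : ∀ t, c t ^ 2 + s t ^ 2 = 1) (t : ℝ) :
    HasDerivAt c (-(angVel c s t * s t)) t ∧ HasDerivAt s (angVel c s t * c t) t := by
  have dc := hc.hasDerivAt_omega t
  have ds := hs.hasDerivAt_omega t
  have h1 := (dc.pow 2).add (ds.pow 2)
  have h2 : c ^ 2 + s ^ 2 = fun _ => (1 : ℝ) := funext h
  rw [h2] at h1
  have h3 := h1.unique (hasDerivAt_const t (1 : ℝ))
  norm_num at h3
  have h4 : c t * deriv c t + s t * deriv s t = 0 := by linarith
  have h5 := h t
  refine ⟨dc.congr_deriv ?_, ds.congr_deriv ?_⟩ <;> unfold angVel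
  · linear_combination (-deriv c t) * h5 + c t * h4
  · linear_combination (-deriv s t) * h5 + s t * h4

/-- The determinant of the first derivatives of the family of lines `(s, -c, w)`. -/
def lineDet (c s w : ℝ → ℝ) (t : ℝ) : ℝ :=
  angVel c s t * deriv (deriv w) t - deriv (angVel c s) t * deriv w t + angVel c s t ^ 3 * w t

section Reflection

variable {a b : ℝ} {p q c s : ℝ → ℝ}

/-- The support function of the lines with direction `(c, s)` through the points `(a p, b q)`. -/
theorem hasDerivAt_support (hp : ContDiff ℝ ω p) (hq : ContDiff ℝ ω q) (hpq : ∀ t, p t ^ 2 + q t ^ 2 = 1)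
    (hc : ContDiff ℝ ω c) (hs : ContDiff ℝ ω s) (hcs : ∀ t, c t ^ 2 + s t ^ 2 = 1) (t : ℝ) :
    HasDerivAt (fun t => b * q t * c t - a * p t * s t)
      (angVel p q t * (b * p t * c t + a * q t * s t)
        - angVel c s t * (b * q t * s t + a * p t * c t)) t := by
  obtain ⟨dp, dq⟩ := hasDerivAt_of_unit hp hq hpq t
  obtain ⟨dc, ds⟩ := hasDerivAt_of_unit hc hs hcs t
  refine (((dq.const_mul b).mul dc).sub ((dp.const_mul a).mul ds)).congr_deriv ?_
  ring

theorem hasDerivAt_normal_component (hp : ContDiff ℝ ω p) (hq : ContDiff ℝ ω q)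
    (hpq : ∀ t, p t ^ 2 + q t ^ 2 = 1)
    (hc : ContDiff ℝ ω c) (hs : ContDiff ℝ ω s) (hcs : ∀ t, c t ^ 2 + s t ^ 2 = 1) (t : ℝ) :
    HasDerivAt (fun t => p t * c t / a + q t * s t / b)
      (angVel p q t * (p t * s t / b - q t * c t / a)
        - angVel c s t * (p t * s t / a - q t * c t / b)) t := by
  obtain ⟨dp, dq⟩ := hasDerivAt_of_unit hp hq hpq t
  obtain ⟨dc, ds⟩ := hasDerivAt_of_unit hc hs hcs t
  refine (((dp.mul dc).div_const a).add ((dq.mul ds).div_const b)).congr_deriv ?_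
  ring

theorem hasDerivAt_tangential_component (hp : ContDiff ℝ ω p) (hq : ContDiff ℝ ω q)
    (hpq : ∀ t, p t ^ 2 + q t ^ 2 = 1)
    (hc : ContDiff ℝ ω c) (hs : ContDiff ℝ ω s) (hcs : ∀ t, c t ^ 2 + s t ^ 2 = 1) (t : ℝ) :
    HasDerivAt (fun t => p t * s t / a - q t * c t / b)
      (angVel c s t * (p t * c t / a + q t * s t / b)
        - angVel p q t * (p t * c t / b + q t * s t / a)) t := by
  obtain ⟨dp, dq⟩ := hasDerivAt_of_unit hp hq hpq t
  obtain ⟨dc, ds⟩ := hasDerivAt_of_unit hc hs hcs t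
  refine (((dp.mul ds).div_const a).sub ((dq.mul dc).div_const b)).congr_deriv ?_
  ring

/-- Expresses the determinant through the quantities that reflection controls: the motion of the
point of incidence and the normal and tangential components of the direction, of which the first
changes sign and the second is kept. -/
theorem lineDet_eq (ha : a ≠ 0) (hb : b ≠ 0) (hp : ContDiff ℝ ω p) (hq : ContDiff ℝ ω q)
    (hpq : ∀ t, p t ^ 2 + q t ^ 2 = 1)
    (hc : ContDiff ℝ ω c) (hs : ContDiff ℝ ω s) (hcs : ∀ t, c t ^ 2 + s t ^ 2 = 1) (t : ℝ) :
    lineDet c s (fun t => b * q t * c t - a * p t * s t) t =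
      a * b * (angVel c s t * (deriv (angVel p q) t * (p t * c t / a + q t * s t / b)
        + angVel p q t * deriv (fun t => p t * c t / a + q t * s t / b) t
        - angVel c s t * angVel p q t * (p t * s t / a - q t * c t / b))
        - angVel p q t * (p t * c t / a + q t * s t / b) * deriv (angVel c s) t) := by
  obtain ⟨dp, dq⟩ := hasDerivAt_of_unit hp hq hpq t
  obtain ⟨dc, ds⟩ := hasDerivAt_of_unit hc hs hcs t
  have dω := (contDiff_angVel hc hs).hasDerivAt_omega t
  have dσ := (contDiff_angVel hp hq).hasDerivAt_omega t
  have e1 : deriv (fun t => b * q t * c t - a * p t * s t) = fun t =>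
      angVel p q t * (b * p t * c t + a * q t * s t)
        - angVel c s t * (b * q t * s t + a * p t * c t) :=
    funext fun t => (hasDerivAt_support hp hq hpq hc hs hcs t).deriv
  have e2 := (dσ.mul ((((dp.const_mul b).mul dc)).add ((dq.const_mul a).mul ds))).sub
    (dω.mul ((((dq.const_mul b).mul ds)).add ((dp.const_mul a).mul dc)))
  have e3 := (congrArg (fun f => deriv f t) e1).trans e2.deriv
  unfold lineDet
  rw [e3, e1, (hasDerivAt_normal_component hp hq hpq hc hs hcs t).deriv]
  simp only [Pi.add_apply, Pi.mul_apply]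
  generalize angVel c s t = w at *
  generalize angVel p q t = σ at *
  field_simp
  ring

variable {c₂ s₂ : ℝ → ℝ}

/-- The derivative of the law of reflection. -/
theorem angVel_add_angVel (ha : a ≠ 0) (hb : b ≠ 0) (hp : ContDiff ℝ ω p) (hq : ContDiff ℝ ω q)
    (hpq : ∀ t, p t ^ 2 + q t ^ 2 = 1)
    (hc : ContDiff ℝ ω c) (hs : ContDiff ℝ ω s) (hcs : ∀ t, c t ^ 2 + s t ^ 2 = 1)
    (hc₂ : ContDiff ℝ ω c₂) (hs₂ : ContDiff ℝ ω s₂) (hcs₂ : ∀ t, c₂ t ^ 2 + s₂ t ^ 2 = 1)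
    (hN : ∀ t, p t * c₂ t / a + q t * s₂ t / b = -(p t * c t / a + q t * s t / b))
    (hT : ∀ t, p t * s₂ t / a - q t * c₂ t / b = p t * s t / a - q t * c t / b)
    {t : ℝ} (hJ : p t * c t / a + q t * s t / b ≠ 0) :
    (angVel c s t + angVel c₂ s₂ t) * (b ^ 2 * p t ^ 2 + a ^ 2 * q t ^ 2)
      = 2 * a * b * angVel p q t := by
  have h1 := hasDerivAt_tangential_component (a := a) (b := b) hp hq hpq hc hs hcs t
  have h2 := hasDerivAt_tangential_component (a := a) (b := b) hp hq hpq hc₂ hs₂ hcs₂ t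
  rw [funext hT] at h2
  have h3 := h1.unique h2
  rw [hN t] at h3
  have hN' := hN t
  have hT' := hT t
  have h4 := hpq t
  generalize angVel c s t = w at *
  generalize angVel c₂ s₂ t = w₂ at *
  generalize angVel p q t = σ at *
  generalize p t = p at *
  generalize q t = q at *
  generalize c t = c at *
  generalize s t = s at *
  generalize c₂ t = c₂ at *
  generalize s₂ t = s₂ at *
  -- `e1` and `e2` solve the law of reflection for the change of direction, which is along the
  -- normal `(b p, a q)`.
  have e1 : (c - c₂) * (b ^ 2 * p ^ 2 + a ^ 2 * q ^ 2)
      = 2 * a * b ^ 2 * p * (p * c / a + q * s / b) := by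
    field_simp at hN' hT' ⊢
    linear_combination (-b * p) * hN' + a * q * hT'
  have e2 : (s - s₂) * (b ^ 2 * p ^ 2 + a ^ 2 * q ^ 2)
      = 2 * a ^ 2 * b * q * (p * c / a + q * s / b) := by
    field_simp at hN' hT' ⊢
    linear_combination (-a * q) * hN' - b * p * hT'
  have e3 : (w + w₂) * (p * c / a + q * s / b) = σ * ((c - c₂) * p / b + (s - s₂) * q / a) := by
    linear_combination h3
  apply mul_right_cancel₀ hJ
  have e4 : (w + w₂) * (b ^ 2 * p ^ 2 + a ^ 2 * q ^ 2) * (p * c / a + q * s / b)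
      = σ * ((c - c₂) * (b ^ 2 * p ^ 2 + a ^ 2 * q ^ 2) * p / b
        + (s - s₂) * (b ^ 2 * p ^ 2 + a ^ 2 * q ^ 2) * q / a) := by
    linear_combination (b ^ 2 * p ^ 2 + a ^ 2 * q ^ 2) * e3
  rw [e4, e1, e2]
  generalize p * c / a + q * s / b = J
  field_simp
  linear_combination (σ * J) * h4

/-- The change of the determinant of a family of lines under reflection in an ellipse. -/
theorem lineDet_reflect (ha : a ≠ 0) (hb : b ≠ 0) (hp : ContDiff ℝ ω p) (hq : ContDiff ℝ ω q)
    (hpq : ∀ t, p t ^ 2 + q t ^ 2 = 1)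
    (hc : ContDiff ℝ ω c) (hs : ContDiff ℝ ω s) (hcs : ∀ t, c t ^ 2 + s t ^ 2 = 1)
    (hc₂ : ContDiff ℝ ω c₂) (hs₂ : ContDiff ℝ ω s₂) (hcs₂ : ∀ t, c₂ t ^ 2 + s₂ t ^ 2 = 1)
    (hN : ∀ t, p t * c₂ t / a + q t * s₂ t / b = -(p t * c t / a + q t * s t / b))
    (hT : ∀ t, p t * s₂ t / a - q t * c₂ t / b = p t * s t / a - q t * c t / b)
    (hJ : ∀ t, p t * c t / a + q t * s t / b ≠ 0) (t : ℝ) :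
    lineDet c₂ s₂ (fun t => b * q t * c₂ t - a * p t * s₂ t) t =
      lineDet c s (fun t => b * q t * c t - a * p t * s t) t -
      6 * a ^ 2 * b ^ 2 * angVel p q t ^ 2 / (b ^ 2 * p t ^ 2 + a ^ 2 * q t ^ 2) *
        deriv (fun t => p t * c t / a + q t * s t / b) t := by
  have hE := angVel_add_angVel ha hb hp hq hpq hc hs hcs hc₂ hs₂ hcs₂ hN hT (hJ t)
  -- The relation between angular velocities holds along the whole family and can be differentiated
  -- again, which controls the angular accelerations.
  have hE' : deriv (fun t => (angVel c s t + angVel c₂ s₂ t) * (b ^ 2 * p t ^ 2 + a ^ 2 * q t ^ 2)) t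
      = deriv (fun t => 2 * a * b * angVel p q t) t := by
    congr 1
    exact funext fun t => angVel_add_angVel ha hb hp hq hpq hc hs hcs hc₂ hs₂ hcs₂ hN hT (hJ t)
  obtain ⟨dp, dq⟩ := hasDerivAt_of_unit hp hq hpq t
  have dω := (contDiff_angVel hc hs).hasDerivAt_omega t
  have dω₂ := (contDiff_angVel hc₂ hs₂).hasDerivAt_omega t
  have dσ := (contDiff_angVel hp hq).hasDerivAt_omega t
  have e1 := ((dω.add dω₂).mul (((dp.pow 2).const_mul (b ^ 2)).add ((dq.pow 2).const_mul (a ^ 2)))).deriv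
  have e2 := (dσ.const_mul (2 * a * b)).deriv
  have hE2 := (e1.symm.trans hE').trans e2
  have hJ' := (hasDerivAt_normal_component (a := a) (b := b) hp hq hpq hc hs hcs t).deriv
  have hJ₂ : deriv (fun t => p t * c₂ t / a + q t * s₂ t / b) t
      = - deriv (fun t => p t * c t / a + q t * s t / b) t := by
    rw [← deriv.fun_neg]
    congr 1
    exact funext hN
  rw [lineDet_eq ha hb hp hq hpq hc₂ hs₂ hcs₂, lineDet_eq ha hb hp hq hpq hc hs hcs, hJ₂, hN t, hT t]
  have h4 := hpq t
  have hn : b ^ 2 * p t ^ 2 + a ^ 2 * q t ^ 2 ≠ 0 := by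
    intro h
    have h5 : b ^ 2 * p t ^ 2 = 0 := by nlinarith [sq_nonneg (b * p t), sq_nonneg (a * q t)]
    have h6 : a ^ 2 * q t ^ 2 = 0 := by nlinarith [sq_nonneg (b * p t), sq_nonneg (a * q t)]
    have h7 : p t = 0 := by simpa [hb] using h5
    have h8 : q t = 0 := by simpa [ha] using h6
    rw [h7, h8] at h4
    norm_num at h4
  simp only [Pi.add_apply, Pi.pow_apply] at hE2
  generalize deriv (fun t => p t * c t / a + q t * s t / b) t = J' at *
  generalize deriv (angVel c s) t = w' at *
  generalize deriv (angVel c₂ s₂) t = w₂' at *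
  generalize deriv (angVel p q) t = σ' at *
  generalize angVel c s t = w at *
  generalize angVel c₂ s₂ t = w₂ at *
  generalize angVel p q t = σ at *
  generalize p t = p at *
  generalize q t = q at *
  generalize c t = c at *
  generalize s t = s at *
  have hM : (b ^ 2 * p ^ 2 + a ^ 2 * q ^ 2) * (p * s / b - q * c / a)
      = a * b * (p * s / a - q * c / b) + (p * c / a + q * s / b) * p * q * (a ^ 2 - b ^ 2) := by
    field_simp
    linear_combination (a * s * b^2 * p - c * a ^ 2 * b * q) * h4
  generalize p * s / b - q * c / a = M at *
  generalize hK : p * s / a - q * c / b = K at *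
  generalize hJJ : p * c / a + q * s / b = J at *
  -- Together with `hJ'`, this eliminates `M`, `K` and the derivative of `b² p² + a² q²`, so that
  -- only `J'` survives in `main`.
  have hB : -2 * a ^ 2 * b ^ 2 * K * (w + w₂) + 4 * a ^ 2 * b ^ 2 * σ * M
      - 2 * a * b * J * (w + w₂) * p * q * (a ^ 2 - b ^ 2) = 0 := by
    apply mul_right_cancel₀ hn
    linear_combination (-2 * a ^ 2 * b ^ 2 * K - 2 * a * b * J * p * q * (a ^ 2 - b ^ 2)) * hE
      + 4 * a ^ 2 * b ^ 2 * σ * hM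
  have main : (a * b * (w₂ * (σ' * -J + σ * -J' - w₂ * σ * K) - σ * -J * w₂') -
      a * b * (w * (σ' * J + σ * J' - w * σ * K) - σ * J * w')) *
      (b ^ 2 * p ^ 2 + a ^ 2 * q ^ 2)
        = -6 * a ^ 2 * b ^ 2 * σ ^ 2 * J' := by
    linear_combination (-a * b * (σ' * J + σ * J') - a * b * σ * K * (w₂ - w)) * hE
      + a * b * σ * J * hE2 + σ ^ 2 * hB + 4 * a ^ 2 * b ^ 2 * σ ^ 2 * hJ'
  linear_combination (eq_div_iff hn).2 main

end Reflection
end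

/-! ### The billiard map and its conserved quantity -/

noncomputable section
namespace EllipticBilliard

variable {a b : ℝ}

/-- The quantity under the root in `exitTime`; for unit directions, `a ^ 2 * b ^ 2` times it is the
parameter of the confocal conic tangent to the ray. -/
def disc (a b : ℝ) (r : Ray) : ℝ :=
  form a b r.1 r.2 ^ 2 + form a b r.2 r.2 * (1 - form a b r.1 r.1)

theorem form_self_pos (ha : a ≠ 0) (hb : b ≠ 0) {v : ℝ × ℝ} (hv : v.1 ^ 2 + v.2 ^ 2 = 1) :
    0 < form a b v v := by
  unfold form
  have h1 : 0 ≤ v.1 * v.1 / a ^ 2 := div_nonneg (mul_self_nonneg _) (sq_nonneg _)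
  have h2 : 0 ≤ v.2 * v.2 / b ^ 2 := div_nonneg (mul_self_nonneg _) (sq_nonneg _)
  refine lt_of_le_of_ne (add_nonneg h1 h2) fun h => ?_
  have h3 : v.1 * v.1 / a ^ 2 = 0 := by linarith
  have h4 : v.2 * v.2 / b ^ 2 = 0 := by linarith
  simp [ha] at h3
  simp [hb] at h4
  simp [h3, h4] at hv

/-- The left side is half the derivative of the quadratic at its larger root, hence the positive
square root. -/
theorem form_exitPoint_dir {r : Ray} (hA : form a b r.2 r.2 ≠ 0) :
    form a b (exitPoint a b r) r.2 = √(disc a b r) := by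
  have h1 : form a b (exitPoint a b r) r.2
      = form a b r.1 r.2 + exitTime a b r * form a b r.2 r.2 := by
    simp only [exitPoint, form, Prod.fst_add, Prod.snd_add, Prod.smul_fst, Prod.smul_snd, smul_eq_mul]
    ring
  rw [h1, exitTime, div_mul_cancel₀ _ hA, disc]
  ring

theorem form_exitPoint_self {r : Ray} (hA : form a b r.2 r.2 ≠ 0) (hd : 0 ≤ disc a b r) :
    form a b (exitPoint a b r) (exitPoint a b r) = 1 := by
  -- The discriminant does not change when the base point moves along the line.
  have h1 : form a b (exitPoint a b r) (exitPoint a b r) * form a b r.2 r.2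
      = form a b (exitPoint a b r) r.2 ^ 2 + form a b r.1 r.1 * form a b r.2 r.2
        - form a b r.1 r.2 ^ 2 := by
    simp only [exitPoint, form, Prod.fst_add, Prod.snd_add, Prod.smul_fst, Prod.smul_snd, smul_eq_mul]
    ring
  rw [form_exitPoint_dir hA, Real.sq_sqrt hd, disc] at h1
  apply mul_right_cancel₀ hA
  rw [h1]
  ring

theorem normal_sq_pos (ha : a ≠ 0) (hb : b ≠ 0) {X : ℝ × ℝ} (hX : form a b X X = 1) :
    0 < (normal a b X).1 ^ 2 + (normal a b X).2 ^ 2 := by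
  refine lt_of_le_of_ne (by positivity) fun h => ?_
  have h1 : (normal a b X).1 = 0 := by nlinarith [sq_nonneg (normal a b X).1, sq_nonneg (normal a b X).2]
  have h2 : (normal a b X).2 = 0 := by nlinarith [sq_nonneg (normal a b X).1, sq_nonneg (normal a b X).2]
  simp [normal, ha] at h1
  simp [normal, hb] at h2
  simp [form, h1, h2] at hX

theorem mirror_normal_component {N : ℝ × ℝ} (hN : N.1 ^ 2 + N.2 ^ 2 ≠ 0) (v : ℝ × ℝ) :
    N.1 * (mirror N v).1 + N.2 * (mirror N v).2 = -(N.1 * v.1 + N.2 * v.2) := by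
  simp only [mirror, Prod.fst_sub, Prod.snd_sub, Prod.smul_fst, Prod.smul_snd, smul_eq_mul]
  field_simp
  ring

theorem mirror_tangential_component (N v : ℝ × ℝ) :
    N.1 * (mirror N v).2 - N.2 * (mirror N v).1 = N.1 * v.2 - N.2 * v.1 := by
  simp only [mirror, Prod.fst_sub, Prod.snd_sub, Prod.smul_fst, Prod.smul_snd, smul_eq_mul]
  ring

theorem mirror_norm {N : ℝ × ℝ} (hN : N.1 ^ 2 + N.2 ^ 2 ≠ 0) (v : ℝ × ℝ) :
    (mirror N v).1 ^ 2 + (mirror N v).2 ^ 2 = v.1 ^ 2 + v.2 ^ 2 := by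
  simp only [mirror, Prod.fst_sub, Prod.snd_sub, Prod.smul_fst, Prod.smul_snd, smul_eq_mul]
  field_simp
  ring

theorem form_eq_normal (X v : ℝ × ℝ) :
    form a b X v = (normal a b X).1 * v.1 + (normal a b X).2 * v.2 := by
  simp only [form, normal]
  ring

/-- The rays on which the billiard map is regular. -/
structure Regular (a b : ℝ) (r : Ray) : Prop where
  norm : r.2.1 ^ 2 + r.2.2 ^ 2 = 1
  disc_pos : 0 < disc a b r

section Bounce

variable (ha : a ≠ 0) (hb : b ≠ 0) {r : Ray} (hr : Regular a b r)
include ha hb hr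

theorem Regular.form_pos : 0 < form a b r.2 r.2 := form_self_pos ha hb hr.norm

theorem Regular.exit_mem : form a b (exitPoint a b r) (exitPoint a b r) = 1 :=
  form_exitPoint_self (hr.form_pos ha hb).ne' hr.disc_pos.le

theorem Regular.form_exit : form a b (exitPoint a b r) r.2 = √(disc a b r) :=
  form_exitPoint_dir (hr.form_pos ha hb).ne'

theorem Regular.normal_ne :
    (normal a b (exitPoint a b r)).1 ^ 2 + (normal a b (exitPoint a b r)).2 ^ 2 ≠ 0 :=
  (normal_sq_pos ha hb (hr.exit_mem ha hb)).ne'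

theorem Regular.form_bounce : form a b (exitPoint a b r) (bounce a b r).2 = -√(disc a b r) := by
  rw [form_eq_normal, bounce, mirror_normal_component (hr.normal_ne ha hb), ← form_eq_normal,
    hr.form_exit ha hb]

/-- On `C` the second summand of `disc` vanishes and the first is the square of the normal
component, whose sign alone is changed by the reflection. -/
theorem Regular.disc_bounce : disc a b (bounce a b r) = disc a b r := by
  have h1 := hr.form_bounce ha hb
  have h2 := hr.exit_mem ha hb
  rw [disc]
  change form a b (exitPoint a b r) (bounce a b r).2 ^ 2 + _ * (1 - form a b (exitPoint a b r) (exitPoint a b r)) = _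
  rw [h1, h2, neg_sq, Real.sq_sqrt hr.disc_pos.le]
  ring

theorem Regular.bounce : Regular a b (bounce a b r) where
  norm := (mirror_norm (hr.normal_ne ha hb) r.2).trans hr.norm
  disc_pos := by rw [hr.disc_bounce ha hb]; exact hr.disc_pos

end Bounce

theorem contDiff_form {f g : ℝ → ℝ × ℝ} (hf : ContDiff ℝ ω f) (hg : ContDiff ℝ ω g) :
    ContDiff ℝ ω (fun t => form a b (f t) (g t)) :=
  ((hf.fst.mul hg.fst).div_const _).add ((hf.snd.mul hg.snd).div_const _)

theorem contDiff_disc {r : ℝ → Ray} (hr : ContDiff ℝ ω r) :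
    ContDiff ℝ ω (fun t => disc a b (r t)) :=
  ((contDiff_form hr.fst hr.snd).pow 2).add
    ((contDiff_form hr.snd hr.snd).mul (contDiff_const.sub (contDiff_form hr.fst hr.fst)))

section Smooth

variable (ha : a ≠ 0) (hb : b ≠ 0) {r : ℝ → Ray} (hr : ContDiff ℝ ω r) (hreg : ∀ t, Regular a b (r t))
include ha hb hr hreg

/-- Positivity of the discriminant keeps the square root analytic. -/
theorem contDiff_exitPoint : ContDiff ℝ ω (fun t => exitPoint a b (r t)) := by
  have h1 : ContDiff ℝ ω (fun t => √(disc a b (r t))) :=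
    (contDiff_disc hr).sqrt fun t => (hreg t).disc_pos.ne'
  have h2 : ContDiff ℝ ω (fun t => exitTime a b (r t)) :=
    ((contDiff_form hr.fst hr.snd).neg.add h1).div (contDiff_form hr.snd hr.snd)
      fun t => ((hreg t).form_pos ha hb).ne'
  exact hr.fst.add (h2.smul hr.snd)

theorem contDiff_bounce : ContDiff ℝ ω (fun t => bounce a b (r t)) := by
  have hX := contDiff_exitPoint ha hb hr hreg
  have hN : ContDiff ℝ ω (fun t => normal a b (exitPoint a b (r t))) :=
    (hX.fst.div_const _).prodMk (hX.snd.div_const _)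
  refine hX.prodMk (hr.snd.sub (ContDiff.smul (ContDiff.div ?_ ?_ ?_) hN))
  · exact contDiff_const.mul ((hr.snd.fst.mul hN.fst).add (hr.snd.snd.mul hN.snd))
  · exact (hN.fst.pow 2).add (hN.snd.pow 2)
  · exact fun t => (hreg t).normal_ne ha hb

end Smooth

/-! ### The pencil of rays -/

section Pencil

variable (ha : a ≠ 0) (hb : b ≠ 0) {O : ℝ × ℝ} (hO : form a b O O < 1)

/-- The ray of angle `t` from `O` after `n` reflections. -/
def ray (a b : ℝ) (O : ℝ × ℝ) (n : ℕ) (t : ℝ) : Ray := (bounce a b)^[n] (pencil O t)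

theorem ray_succ (a b : ℝ) (O : ℝ × ℝ) (n : ℕ) (t : ℝ) :
    ray a b O (n + 1) t = bounce a b (ray a b O n t) :=
  Function.iterate_succ_apply' _ _ _

include ha hb hO

/-- Since `O` is strictly inside `C`, the second summand of `disc` is positive in every direction.
-/
theorem regular_pencil (t : ℝ) : Regular a b (pencil O t) := by
  have h : (pencil O t).2.1 ^ 2 + (pencil O t).2.2 ^ 2 = 1 := Real.cos_sq_add_sin_sq t
  refine ⟨h, ?_⟩
  have h1 := form_self_pos ha hb h
  have h2 : 0 < 1 - form a b O O := by linarith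
  exact add_pos_of_nonneg_of_pos (sq_nonneg _) (mul_pos h1 h2)

theorem regular_ray (n : ℕ) (t : ℝ) : Regular a b (ray a b O n t) := by
  induction n with
  | zero => exact regular_pencil ha hb hO t
  | succ n ih => rw [ray_succ]; exact ih.bounce ha hb

theorem disc_ray (n : ℕ) (t : ℝ) : disc a b (ray a b O n t) = disc a b (pencil O t) := by
  induction n with
  | zero => rfl
  | succ n ih => rw [ray_succ, (regular_ray ha hb hO n t).disc_bounce ha hb, ih]

theorem contDiff_ray (n : ℕ) : ContDiff ℝ ω (ray a b O n) := by
  induction n with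
  | zero => exact contDiff_const.prodMk (Real.contDiff_cos.prodMk Real.contDiff_sin)
  | succ n ih =>
    have : ray a b O (n + 1) = fun t => bounce a b (ray a b O n t) := funext (ray_succ a b O n)
    rw [this]
    exact contDiff_bounce ha hb ih (regular_ray ha hb hO n)

end Pencil

/-! ### Iterated reflection of the pencil -/

variable {O : ℝ × ℝ}

/-- The coordinate `w` of the line `(s, -c, w)` of a ray of direction `(c, s)`. -/
def support (r : Ray) : ℝ := r.1.2 * r.2.1 - r.1.1 * r.2.2

theorem support_exitPoint (a b : ℝ) (r : Ray) :
    support (exitPoint a b r, r.2) = support r := by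
  simp only [support, exitPoint, Prod.fst_add, Prod.snd_add, Prod.smul_fst, Prod.smul_snd, smul_eq_mul]
  ring

def rayCos (a b : ℝ) (O : ℝ × ℝ) (n : ℕ) (t : ℝ) : ℝ := (ray a b O n t).2.1
def raySin (a b : ℝ) (O : ℝ × ℝ) (n : ℕ) (t : ℝ) : ℝ := (ray a b O n t).2.2
def raySupport (a b : ℝ) (O : ℝ × ℝ) (n : ℕ) (t : ℝ) : ℝ := support (ray a b O n t)

/-- The coordinates of the point at which the ray hits the ellipse, divided by the semiaxes. -/
def hitCos (a b : ℝ) (O : ℝ × ℝ) (n : ℕ) (t : ℝ) : ℝ := (exitPoint a b (ray a b O n t)).1 / a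
def hitSin (a b : ℝ) (O : ℝ × ℝ) (n : ℕ) (t : ℝ) : ℝ := (exitPoint a b (ray a b O n t)).2 / b

theorem raySupport_eq (ha : a ≠ 0) (hb : b ≠ 0) (n : ℕ) (t : ℝ) :
    raySupport a b O n t =
      b * hitSin a b O n t * rayCos a b O n t - a * hitCos a b O n t * raySin a b O n t := by
  rw [raySupport, ← support_exitPoint a b, support, rayCos, raySin, hitSin, hitCos,
    mul_div_cancel₀ _ hb, mul_div_cancel₀ _ ha]

theorem raySupport_succ_eq (ha : a ≠ 0) (hb : b ≠ 0) (n : ℕ) (t : ℝ) :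
    raySupport a b O (n + 1) t = b * hitSin a b O n t * rayCos a b O (n + 1) t
      - a * hitCos a b O n t * raySin a b O (n + 1) t := by
  rw [raySupport, support, rayCos, raySin, hitSin, hitCos, mul_div_cancel₀ _ hb,
    mul_div_cancel₀ _ ha, ray_succ]
  rfl

section

variable (ha : a ≠ 0) (hb : b ≠ 0) (hO : form a b O O < 1) (n : ℕ)
include ha hb hO

theorem contDiff_rayCos : ContDiff ℝ ω (rayCos a b O n) := (contDiff_ray ha hb hO n).snd.fst
theorem contDiff_raySin : ContDiff ℝ ω (raySin a b O n) := (contDiff_ray ha hb hO n).snd.snd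
theorem contDiff_raySupport : ContDiff ℝ ω (raySupport a b O n) :=
  ((contDiff_ray ha hb hO n).fst.snd.mul (contDiff_ray ha hb hO n).snd.fst).sub
    ((contDiff_ray ha hb hO n).fst.fst.mul (contDiff_ray ha hb hO n).snd.snd)
theorem contDiff_hitCos : ContDiff ℝ ω (hitCos a b O n) :=
  (contDiff_exitPoint ha hb (contDiff_ray ha hb hO n) (regular_ray ha hb hO n)).fst.div_const _
theorem contDiff_hitSin : ContDiff ℝ ω (hitSin a b O n) :=
  (contDiff_exitPoint ha hb (contDiff_ray ha hb hO n) (regular_ray ha hb hO n)).snd.div_const _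

theorem rayCos_sq_add (t : ℝ) : rayCos a b O n t ^ 2 + raySin a b O n t ^ 2 = 1 :=
  (regular_ray ha hb hO n t).norm

theorem hitCos_sq_add (t : ℝ) : hitCos a b O n t ^ 2 + hitSin a b O n t ^ 2 = 1 := by
  rw [← (regular_ray ha hb hO n t).exit_mem ha hb, form, hitCos, hitSin]
  ring

/-- The right side does not depend on `n`. This is why the contributions of all the reflections to
the determinant are multiples of one and the same derivative. -/
theorem hit_normal (t : ℝ) :
    hitCos a b O n t * rayCos a b O n t / a + hitSin a b O n t * raySin a b O n t / b
      = √(disc a b (pencil O t)) := by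
  rw [← disc_ray ha hb hO n t, ← (regular_ray ha hb hO n t).form_exit ha hb, form, hitCos, hitSin,
    rayCos, raySin]
  ring

theorem hit_normal_succ (t : ℝ) :
    hitCos a b O n t * rayCos a b O (n + 1) t / a + hitSin a b O n t * raySin a b O (n + 1) t / b
      = -(hitCos a b O n t * rayCos a b O n t / a + hitSin a b O n t * raySin a b O n t / b) := by
  rw [hit_normal ha hb hO, ← disc_ray ha hb hO n t, ← (regular_ray ha hb hO n t).form_bounce ha hb,
    form, hitCos, hitSin, rayCos, raySin, ray_succ]
  ring

omit ha hb hO in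
theorem hit_tangential_succ (t : ℝ) :
    hitCos a b O n t * raySin a b O (n + 1) t / a - hitSin a b O n t * rayCos a b O (n + 1) t / b
      = hitCos a b O n t * raySin a b O n t / a - hitSin a b O n t * rayCos a b O n t / b := by
  have := mirror_tangential_component (normal a b (exitPoint a b (ray a b O n t))) (ray a b O n t).2
  simp only [normal] at this
  simp only [hitCos, hitSin, rayCos, raySin, ray_succ, bounce, normal]
  linear_combination this

theorem hit_normal_ne (t : ℝ) :
    hitCos a b O n t * rayCos a b O n t / a + hitSin a b O n t * raySin a b O n t / b ≠ 0 := by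
  rw [hit_normal ha hb hO]
  exact (Real.sqrt_pos.2 (regular_pencil ha hb hO t).disc_pos).ne'

theorem lineDet_ray_succ (t : ℝ) :
    lineDet (rayCos a b O (n + 1)) (raySin a b O (n + 1)) (raySupport a b O (n + 1)) t =
      lineDet (rayCos a b O n) (raySin a b O n) (raySupport a b O n) t -
      6 * a ^ 2 * b ^ 2 * angVel (hitCos a b O n) (hitSin a b O n) t ^ 2 /
        (b ^ 2 * hitCos a b O n t ^ 2 + a ^ 2 * hitSin a b O n t ^ 2) *
        deriv (fun t => √(disc a b (pencil O t))) t := by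
  rw [funext (raySupport_succ_eq ha hb n), funext (raySupport_eq ha hb n),
    ← funext (hit_normal ha hb hO n)]
  exact lineDet_reflect ha hb (contDiff_hitCos ha hb hO n) (contDiff_hitSin ha hb hO n)
    (hitCos_sq_add ha hb hO n) (contDiff_rayCos ha hb hO n) (contDiff_raySin ha hb hO n)
    (rayCos_sq_add ha hb hO n) (contDiff_rayCos ha hb hO (n + 1)) (contDiff_raySin ha hb hO (n + 1))
    (rayCos_sq_add ha hb hO (n + 1)) (hit_normal_succ ha hb hO n) (hit_tangential_succ n)
    (hit_normal_ne ha hb hO n) t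

theorem hit_denom_pos (t : ℝ) : 0 < b ^ 2 * hitCos a b O n t ^ 2 + a ^ 2 * hitSin a b O n t ^ 2 := by
  have h := (regular_ray ha hb hO n t).normal_ne ha hb
  have h1 : (0 : ℝ) < a ^ 2 * b ^ 2 * ((normal a b (exitPoint a b (ray a b O n t))).1 ^ 2
      + (normal a b (exitPoint a b (ray a b O n t))).2 ^ 2) := by positivity
  refine h1.trans_eq ?_
  simp only [normal, hitCos, hitSin]
  field_simp

omit hO ha hb in
theorem angVel_rayCos_zero (t : ℝ) : angVel (rayCos a b O 0) (raySin a b O 0) t = 1 := by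
  have h1 : rayCos a b O 0 = Real.cos := rfl
  have h2 : raySin a b O 0 = Real.sin := rfl
  rw [h1, h2, angVel, Real.deriv_cos, Real.deriv_sin, ← Real.cos_sq_add_sin_sq t]
  ring

omit hO ha hb in
theorem hasDerivAt_raySupport_zero (t : ℝ) :
    HasDerivAt (raySupport a b O 0) (-(O.1 * Real.cos t + O.2 * Real.sin t)) t := by
  refine (((Real.hasDerivAt_cos t).const_mul O.2).sub
    ((Real.hasDerivAt_sin t).const_mul O.1)).congr_deriv ?_
  ring

-- The lines of the pencil all pass through `O`, so the line and its first two derivatives are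
-- linearly dependent.
omit hO ha hb in
theorem lineDet_ray_zero (t : ℝ) :
    lineDet (rayCos a b O 0) (raySin a b O 0) (raySupport a b O 0) t = 0 := by
  have h1 : deriv (raySupport a b O 0) = fun t => -(O.1 * Real.cos t + O.2 * Real.sin t) :=
    funext fun t => (hasDerivAt_raySupport_zero t).deriv
  have h2 := ((((Real.hasDerivAt_cos t).const_mul O.1).add
    ((Real.hasDerivAt_sin t).const_mul O.2)).neg).deriv
  have h3 := (congrArg (fun f => deriv f t) h1).trans h2
  have h4 : angVel (rayCos a b O 0) (raySin a b O 0) = fun _ => 1 := funext angVel_rayCos_zero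
  rw [lineDet, h3, h4, deriv_const]
  simp only [raySupport, support, ray, Function.iterate_zero, id, pencil]
  ring

/-- The point at which the rays of the pencil first hit the ellipse moves with nonzero speed. -/
theorem angVel_hit_zero_mul (t : ℝ) :
    a * b * angVel (hitCos a b O 0) (hitSin a b O 0) t * √(disc a b (pencil O t))
      = exitTime a b (pencil O t) := by
  have h := hasDerivAt_support (a := a) (b := b) (contDiff_hitCos ha hb hO 0)
    (contDiff_hitSin ha hb hO 0) (hitCos_sq_add ha hb hO 0) (contDiff_rayCos ha hb hO 0)
    (contDiff_raySin ha hb hO 0) (rayCos_sq_add ha hb hO 0) t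
  rw [← funext (raySupport_eq (O := O) ha hb 0)] at h
  have h1 := h.unique (hasDerivAt_raySupport_zero t)
  rw [angVel_rayCos_zero, one_mul] at h1
  rw [← hit_normal ha hb hO 0 t]
  have e1 : a * hitCos a b O 0 t = O.1 + exitTime a b (pencil O t) * Real.cos t := by
    rw [hitCos, mul_div_cancel₀ _ ha]; rfl
  have e2 : b * hitSin a b O 0 t = O.2 + exitTime a b (pencil O t) * Real.sin t := by
    rw [hitSin, mul_div_cancel₀ _ hb]; rfl
  have e3 : rayCos a b O 0 t = Real.cos t := rfl
  have e4 : raySin a b O 0 t = Real.sin t := rfl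
  rw [e3, e4] at h1 ⊢
  rw [e1, e2] at h1
  have e5 : a * b * angVel (hitCos a b O 0) (hitSin a b O 0) t *
      (hitCos a b O 0 t * Real.cos t / a + hitSin a b O 0 t * Real.sin t / b) =
      angVel (hitCos a b O 0) (hitSin a b O 0) t * (b * hitCos a b O 0 t * Real.cos t +
        a * hitSin a b O 0 t * Real.sin t) := by field_simp
  rw [e5]
  linear_combination h1 + exitTime a b (pencil O t) * Real.cos_sq_add_sin_sq t

theorem exitTime_pencil_pos (t : ℝ) : 0 < exitTime a b (pencil O t) := by
  have hreg := regular_pencil ha hb hO t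
  have hA := hreg.form_pos ha hb
  refine div_pos ?_ hA
  have h1 : form a b O (pencil O t).2 ^ 2 < disc a b (pencil O t) :=
    lt_add_of_pos_right _ (mul_pos hA (by change 0 < 1 - form a b O O; linarith))
  have h2 := Real.lt_sqrt_of_sq_lt h1
  change 0 < -form a b O (pencil O t).2 + √(disc a b (pencil O t))
  linarith

theorem angVel_hit_zero_ne (t : ℝ) : angVel (hitCos a b O 0) (hitSin a b O 0) t ≠ 0 := by
  intro h
  have h1 := angVel_hit_zero_mul ha hb hO t
  rw [h] at h1
  have := exitTime_pencil_pos ha hb hO t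
  simp at h1
  linarith

/-- The determinant of the reflected lines and their derivatives is a nonvanishing multiple of the
derivative of the conserved quantity. -/
theorem exists_lineDet_ray_eq : ∃ S : ℝ → ℝ, ContDiff ℝ ω S ∧ (∀ t, 0 ≤ S t) ∧
    (1 ≤ n → ∀ t, 0 < S t) ∧
    ∀ t, lineDet (rayCos a b O n) (raySin a b O n) (raySupport a b O n) t
      = -S t * deriv (fun t => √(disc a b (pencil O t))) t := by
  induction n with
  | zero => exact ⟨fun _ => 0, contDiff_const, fun _ => le_rfl, fun h => by omega,
      fun t => by rw [lineDet_ray_zero]; ring⟩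
  | succ n ih =>
    obtain ⟨S, hS, h0, h1, hD⟩ := ih
    refine ⟨fun t => S t + 6 * a ^ 2 * b ^ 2 * angVel (hitCos a b O n) (hitSin a b O n) t ^ 2 /
        (b ^ 2 * hitCos a b O n t ^ 2 + a ^ 2 * hitSin a b O n t ^ 2), ?_, ?_, ?_, ?_⟩
    · have hp := contDiff_hitCos ha hb hO n
      have hq := contDiff_hitSin ha hb hO n
      refine hS.add ((contDiff_const.mul ((contDiff_angVel hp hq).pow 2)).div
        ((contDiff_const.mul (hp.pow 2)).add (contDiff_const.mul (hq.pow 2))) ?_)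
      exact fun t => (hit_denom_pos ha hb hO n t).ne'
    · intro t
      have := hit_denom_pos ha hb hO n t
      have := h0 t
      positivity
    · intro _ t
      have hd := hit_denom_pos ha hb hO n t
      -- Strict positivity comes from the first reflection, where the hit point has nonzero speed.
      -- Later hit points may be stationary, but their contributions are still nonnegative.
      rcases Nat.eq_zero_or_pos n with rfl | hn
      · have := angVel_hit_zero_ne ha hb hO t
        have := h0 t
        positivity
      · have := h1 hn t
        positivity
    · intro t
      rw [lineDet_ray_succ ha hb hO, hD]
      ring

/-- The families of reflected lines are immersed. -/
theorem raySupport_immersed (t : ℝ) :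
    ¬ (angVel (rayCos a b O n) (raySin a b O n) t = 0 ∧ deriv (raySupport a b O n) t = 0) := by
  induction n with
  | zero => rw [angVel_rayCos_zero]; simp
  | succ n ih =>
    rintro ⟨h1, h2⟩
    have e1 := (hasDerivAt_support (a := a) (b := b) (contDiff_hitCos ha hb hO n)
      (contDiff_hitSin ha hb hO n) (hitCos_sq_add ha hb hO n) (contDiff_rayCos ha hb hO (n + 1))
      (contDiff_raySin ha hb hO (n + 1)) (rayCos_sq_add ha hb hO (n + 1)) t).deriv
    rw [← funext (raySupport_succ_eq (O := O) ha hb n), h2, h1] at e1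
    have e2 := (hasDerivAt_support (a := a) (b := b) (contDiff_hitCos ha hb hO n)
      (contDiff_hitSin ha hb hO n) (hitCos_sq_add ha hb hO n) (contDiff_rayCos ha hb hO n)
      (contDiff_raySin ha hb hO n) (rayCos_sq_add ha hb hO n) t).deriv
    rw [← funext (raySupport_eq (O := O) ha hb n)] at e2
    have e3 := angVel_add_angVel ha hb (contDiff_hitCos ha hb hO n) (contDiff_hitSin ha hb hO n)
      (hitCos_sq_add ha hb hO n) (contDiff_rayCos ha hb hO n) (contDiff_raySin ha hb hO n)
      (rayCos_sq_add ha hb hO n) (contDiff_rayCos ha hb hO (n + 1))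
      (contDiff_raySin ha hb hO (n + 1)) (rayCos_sq_add ha hb hO (n + 1))
      (hit_normal_succ ha hb hO n) (hit_tangential_succ n) (hit_normal_ne ha hb hO n t)
    -- If the outgoing line is stationary, the point of incidence is too, because the line crosses
    -- `C` transversally. The law of reflection then makes the incoming line stationary.
    have hσ : angVel (hitCos a b O n) (hitSin a b O n) t = 0 := by
      have e4 : angVel (hitCos a b O n) (hitSin a b O n) t *
          (a * b * (hitCos a b O n t * rayCos a b O (n + 1) t / a
            + hitSin a b O n t * raySin a b O (n + 1) t / b)) = 0 := by
        field_simp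
        linear_combination -e1
      have e5 := hit_normal_ne ha hb hO n t
      rw [hit_normal_succ ha hb hO] at e4
      exact (mul_eq_zero.1 e4).resolve_right (mul_ne_zero (mul_ne_zero ha hb) (neg_ne_zero.2 e5))
    have hd := hit_denom_pos ha hb hO n t
    rw [hσ, h1, add_zero, mul_zero] at e3
    have e6 := (mul_eq_zero.1 e3).resolve_right hd.ne'
    refine ih ⟨e6, ?_⟩
    rw [e2, hσ, e6]
    ring

end

/-! ### Line coordinates and the caustic -/

theorem contDiff_line {c s w : ℝ → ℝ} (hc : ContDiff ℝ ω c) (hs : ContDiff ℝ ω s)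
    (hw : ContDiff ℝ ω w) : ContDiff ℝ ω (fun t => ![s t, -c t, w t]) := by
  rw [contDiff_pi]
  intro i
  fin_cases i
  · exact hs
  · exact hc.neg
  · exact hw

theorem hasDerivAt_line {c s w : ℝ → ℝ} {c' s' w' t : ℝ} (hc : HasDerivAt c c' t)
    (hs : HasDerivAt s s' t) (hw : HasDerivAt w w' t) :
    HasDerivAt (fun t => ![s t, -c t, w t]) ![s', -c', w'] t := by
  rw [hasDerivAt_pi]
  intro i
  fin_cases i
  · exact hs
  · exact hc.neg
  · exact hw

theorem _root_.HasDerivAt.tripleProduct {f g h : ℝ → Fin 3 → ℝ} {f' g' h' : Fin 3 → ℝ} {t : ℝ}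
    (hf : HasDerivAt f f' t) (hg : HasDerivAt g g' t) (hh : HasDerivAt h h' t) :
    HasDerivAt (fun t => f t ⬝ᵥ crossProduct (g t) (h t))
      (f' ⬝ᵥ crossProduct (g t) (h t) + f t ⬝ᵥ crossProduct g' (h t)
        + f t ⬝ᵥ crossProduct (g t) h') t := by
  rw [hasDerivAt_pi] at hf hg hh
  simp only [cross_apply, dotProduct, Fin.sum_univ_three, Matrix.cons_val_zero,
    Matrix.cons_val_one, Matrix.cons_val]
  have h1 := (hf 0).mul (((hg 1).mul (hh 2)).sub ((hg 2).mul (hh 1)))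
  have h2 := (hf 1).mul (((hg 2).mul (hh 0)).sub ((hg 0).mul (hh 2)))
  have h3 := (hf 2).mul (((hg 0).mul (hh 1)).sub ((hg 1).mul (hh 0)))
  refine ((h1.add h2).add h3).congr_deriv ?_
  simp only [Pi.sub_apply, Pi.mul_apply]
  ring

theorem tripleProduct_eq_lineDet {c s w : ℝ → ℝ} (hc : ContDiff ℝ ω c) (hs : ContDiff ℝ ω s)
    (hw : ContDiff ℝ ω w) (h : ∀ t, c t ^ 2 + s t ^ 2 = 1) (t : ℝ) :
    ![s t, -c t, w t] ⬝ᵥ crossProduct (deriv (fun t => ![s t, -c t, w t]) t)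
      (deriv (deriv (fun t => ![s t, -c t, w t])) t) = lineDet c s w t := by
  have hd : deriv (fun t => ![s t, -c t, w t])
      = fun t => ![angVel c s t * c t, -(-(angVel c s t * s t)), deriv w t] := funext fun t =>
    (hasDerivAt_line (hasDerivAt_of_unit hc hs h t).1 (hasDerivAt_of_unit hc hs h t).2
      (hw.hasDerivAt_omega t)).deriv
  obtain ⟨dc, ds⟩ := hasDerivAt_of_unit hc hs h t
  have dω := (contDiff_angVel hc hs).hasDerivAt_omega t
  have hd2 := (congrArg (fun f => deriv f t) hd).trans (hasDerivAt_line (dω.mul ds).neg (dω.mul dc)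
    (hw.deriv_omega.hasDerivAt_omega t)).deriv
  rw [hd2, hd, lineDet]
  simp only [cross_apply, dotProduct, Fin.sum_univ_three, Matrix.cons_val_zero,
    Matrix.cons_val_one, Matrix.cons_val]
  have h4 := h t
  linear_combination (angVel c s t * deriv (deriv w) t - deriv (angVel c s) t * deriv w t
    + angVel c s t ^ 3 * w t) * h4

/-- The last coordinate of the cross product is the angular velocity; where that vanishes, the other
two are `-c w'` and `-s w'`. -/
theorem line_cross_deriv_ne_zero {c s w : ℝ → ℝ} (hc : ContDiff ℝ ω c) (hs : ContDiff ℝ ω s)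
    (hw : ContDiff ℝ ω w) (h : ∀ t, c t ^ 2 + s t ^ 2 = 1) {t : ℝ}
    (hi : ¬ (angVel c s t = 0 ∧ deriv w t = 0)) :
    crossProduct ![s t, -c t, w t] (deriv (fun t => ![s t, -c t, w t]) t) ≠ 0 := by
  obtain ⟨dc, ds⟩ := hasDerivAt_of_unit hc hs h t
  rw [(hasDerivAt_line dc ds (hw.hasDerivAt_omega t)).deriv]
  intro h0
  have h4 := h t
  have e0 := congrFun h0 0
  have e1 := congrFun h0 1
  have e2 := congrFun h0 2
  simp only [cross_apply, Matrix.cons_val_zero, Matrix.cons_val_one, Matrix.cons_val,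
    Pi.zero_apply] at e0 e1 e2
  have hω : angVel c s t = 0 := by linear_combination e2 - angVel c s t * h4
  rw [hω] at e0 e1
  refine hi ⟨hω, ?_⟩
  linear_combination (-deriv w t) * h4 - c t * e0 - s t * e1

section Caustic

variable (ha : a ≠ 0) (hb : b ≠ 0) (hO : form a b O O < 1) (n : ℕ)
include ha hb hO

theorem contDiff_reflectedLine : ContDiff ℝ ω (reflectedLine a b O n) :=
  contDiff_line (contDiff_rayCos ha hb hO n) (contDiff_raySin ha hb hO n)
    (contDiff_raySupport ha hb hO n)

theorem tripleProduct_reflectedLine (t : ℝ) :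
    reflectedLine a b O n t ⬝ᵥ crossProduct (deriv (reflectedLine a b O n) t)
      (deriv (deriv (reflectedLine a b O n)) t) =
      lineDet (rayCos a b O n) (raySin a b O n) (raySupport a b O n) t :=
  tripleProduct_eq_lineDet (contDiff_rayCos ha hb hO n) (contDiff_raySin ha hb hO n)
    (contDiff_raySupport ha hb hO n) (rayCos_sq_add ha hb hO n) t

theorem caustic_ne_zero (t : ℝ) : caustic a b O n t ≠ 0 :=
  line_cross_deriv_ne_zero (contDiff_rayCos ha hb hO n) (contDiff_raySin ha hb hO n)
    (contDiff_raySupport ha hb hO n) (rayCos_sq_add ha hb hO n)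
    (raySupport_immersed ha hb hO n t)

theorem isEnvelope_caustic : IsEnvelope (reflectedLine a b O n) (caustic a b O n) := by
  have hl := contDiff_reflectedLine ha hb hO n
  have hc : ContDiff ℝ ω (caustic a b O n) := by
    rw [contDiff_pi]
    intro i
    have := hl.dotProduct_cross hl.deriv_omega (Pi.single i 1)
    simp only [single_one_dotProduct] at this
    exact this
  refine ⟨hc.of_le le_top, fun t => ⟨caustic_ne_zero ha hb hO n t, ?_, ?_⟩⟩
  · rw [caustic, dot_self_cross]
  · have h1 := (hl.hasDerivAt_omega t).dotProduct_cross (hl.deriv_omega.hasDerivAt_omega t)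
      (reflectedLine a b O n t)
    rw [cross_self, dotProduct_zero, dot_self_cross, add_zero] at h1
    have h2 : HasDerivAt (fun s => reflectedLine a b O n t ⬝ᵥ caustic a b O n s)
        (reflectedLine a b O n t ⬝ᵥ deriv (caustic a b O n) t) t := by
      have := hc.hasDerivAt_omega t
      rw [hasDerivAt_pi] at this
      simp only [dotProduct]
      exact HasDerivAt.fun_sum fun i _ => (this i).const_mul _
    exact h2.unique h1

/-- The caustics have ordinary cusps at the nondegenerate critical points of the conserved
quantity. -/
theorem isCuspAt_caustic (hn : 1 ≤ n) {t : ℝ} (h1 : deriv (fun t => disc a b (pencil O t)) t = 0)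
    (h2 : deriv (deriv (fun t => disc a b (pencil O t))) t ≠ 0) :
    IsCuspAt (caustic a b O n) t := by
  have hl := contDiff_reflectedLine ha hb hO n
  have hd : ContDiff ℝ ω (fun t => disc a b (pencil O t)) :=
    contDiff_disc (contDiff_ray ha hb hO 0)
  have hpos : ∀ t, 0 < disc a b (pencil O t) := fun t => (regular_pencil ha hb hO t).disc_pos
  obtain ⟨S, hS, -, hSpos, hD⟩ := exists_lineDet_ray_eq ha hb hO n
  have hJ : ∀ t, deriv (fun t => √(disc a b (pencil O t))) t
      = deriv (fun t => disc a b (pencil O t)) t / (2 * √(disc a b (pencil O t))) := fun t =>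
    ((hd.hasDerivAt_omega t).sqrt (hpos t).ne').deriv
  set R : ℝ → ℝ := fun t => -S t / (2 * √(disc a b (pencil O t))) with hR
  have hRd : ContDiff ℝ ω R := hS.neg.div (contDiff_const.mul (hd.sqrt fun t => (hpos t).ne'))
    fun t => (mul_pos two_pos (Real.sqrt_pos.2 (hpos t))).ne'
  have hRt : R t ≠ 0 := div_ne_zero (neg_ne_zero.2 (hSpos hn t).ne')
    (mul_pos two_pos (Real.sqrt_pos.2 (hpos t))).ne'
  have hT : (fun t => reflectedLine a b O n t ⬝ᵥ crossProduct (deriv (reflectedLine a b O n) t)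
      (deriv (deriv (reflectedLine a b O n)) t)) =
      fun t => R t * deriv (fun t => disc a b (pencil O t)) t := funext fun t => by
    rw [tripleProduct_reflectedLine ha hb hO, hD, hJ, hR]
    ring
  refine ⟨2, isMCuspAt_two_of_det hl ?_ ?_⟩
  · rw [congrFun hT t, h1, mul_zero]
  · have e1 := (hl.hasDerivAt_omega t).tripleProduct (hl.deriv_omega.hasDerivAt_omega t)
      (hl.deriv_omega.deriv_omega.hasDerivAt_omega t)
    rw [hT] at e1
    have e2 := (hRd.hasDerivAt_omega t).mul (hd.deriv_omega.hasDerivAt_omega t)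
    have e3 := e1.unique e2
    rw [dot_self_cross, cross_self, dotProduct_zero, zero_add, zero_add, h1, mul_zero,
      zero_add] at e3
    rw [e3]
    exact mul_ne_zero hRt h2

end Caustic

/-- The right side is the dual quadratic form of `C`. For a unit direction, subtracting `l` from it
gives the dual form of the confocal conic of parameter `l`. -/
theorem sq_mul_disc (ha : a ≠ 0) (hb : b ≠ 0) (r : Ray) :
    a ^ 2 * b ^ 2 * disc a b r = a ^ 2 * r.2.2 ^ 2 + b ^ 2 * r.2.1 ^ 2 - support r ^ 2 := by
  simp only [disc, form, support]
  field_simp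
  ring

/-! ### The angles of the tangent rays -/

theorem exists_angle_orthogonal {e : ℝ × ℝ} (he : e ≠ 0) : ∃ φ ∈ Set.Ico 0 Real.pi,
    ∃ ρ : ℝ, ρ ≠ 0 ∧ e = (-ρ * Real.sin φ, ρ * Real.cos φ) := by
  set z : ℂ := ⟨e.2, -e.1⟩ with hz
  have hz0 : z ≠ 0 := fun h => he (by
    have h1 := congrArg Complex.re h
    have h2 := congrArg Complex.im h
    simp [hz] at h1 h2
    exact Prod.ext h2 h1)
  have hn : ‖z‖ ≠ 0 := norm_ne_zero_iff.2 hz0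
  have hc : ‖z‖ * Real.cos z.arg = e.2 := Complex.norm_mul_cos_arg z
  have hs : ‖z‖ * Real.sin z.arg = -e.1 := Complex.norm_mul_sin_arg z
  have hlo := Complex.neg_pi_lt_arg z
  have hhi := Complex.arg_le_pi z
  rcases lt_or_ge z.arg 0 with h | h
  · refine ⟨z.arg + Real.pi, ⟨by linarith, by linarith⟩, -‖z‖, neg_ne_zero.2 hn, ?_⟩
    rw [Real.sin_add_pi, Real.cos_add_pi]
    ext
    · dsimp only; linarith
    · dsimp only; linarith
  · rcases hhi.lt_or_eq with h' | h'
    · refine ⟨z.arg, ⟨h, h'⟩, ‖z‖, hn, ?_⟩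
      ext
      · dsimp only; linarith
      · dsimp only; linarith
    · refine ⟨0, ⟨le_rfl, Real.pi_pos⟩, -‖z‖, neg_ne_zero.2 hn, ?_⟩
      rw [h', Real.sin_pi] at hs
      rw [h', Real.cos_pi] at hc
      ext
      · simp; linarith
      · simp; linarith

theorem ncard_angles_orthogonal {e : ℝ × ℝ} (he : e ≠ 0) :
    {θ | θ ∈ Set.Ico 0 (2 * Real.pi) ∧ e.1 * Real.cos θ + e.2 * Real.sin θ = 0}.ncard = 2 := by
  obtain ⟨φ, ⟨h0, h1⟩, ρ, hρ, rfl⟩ := exists_angle_orthogonal he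
  have hπ := Real.pi_pos
  have hset : {θ | θ ∈ Set.Ico 0 (2 * Real.pi) ∧
      -ρ * Real.sin φ * Real.cos θ + ρ * Real.cos φ * Real.sin θ = 0} = {φ, φ + Real.pi} := by
    ext θ
    have hsin : -ρ * Real.sin φ * Real.cos θ + ρ * Real.cos φ * Real.sin θ
        = ρ * Real.sin (θ - φ) := by
      rw [Real.sin_sub]
      ring
    rw [Set.mem_ofPred_eq, hsin, mul_eq_zero, or_iff_right hρ, Set.mem_insert_iff,
      Set.mem_singleton_iff]
    constructor
    · rintro ⟨⟨h2, h3⟩, h4⟩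
      obtain ⟨k, hk⟩ := Real.sin_eq_zero_iff.1 h4
      have k1 : -1 < k := by
        by_contra hcon
        have : (k : ℝ) ≤ -1 := by exact_mod_cast (not_lt.1 hcon)
        nlinarith
      have k2 : k < 2 := by
        by_contra hcon
        have : (2 : ℝ) ≤ k := by exact_mod_cast (not_lt.1 hcon)
        nlinarith
      have : k = 0 ∨ k = 1 := by omega
      rcases this with rfl | rfl
      · left
        push_cast at hk
        linarith
      · right
        push_cast at hk
        linarith
    · rintro (rfl | rfl)
      · exact ⟨⟨h0, by linarith⟩, by simp⟩
      · exact ⟨⟨by linarith, by linarith⟩, by simp⟩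
  rw [hset]
  exact Set.ncard_pair (by linarith)

/-! ### The confocal curves through a point -/

/-- `K` is the confocal conic of parameter `l` through `O`, or an axis of the confocal family
through `O`, which is then considered as degenerate conic of parameter `l`. -/
def IsConfocalThrough (a b : ℝ) (O : ℝ × ℝ) (K : Curve) (l : ℝ) : Prop :=
  (K = confocalConic a b l ∧ l ≠ a ^ 2 ∧ l ≠ b ^ 2 ∧ OnConfocalConic a b l O) ∨
  ∃ L : ℝ × ℝ, K = .line ![L.1, L.2, 0] ∧ L ≠ 0 ∧ L.1 * O.1 + L.2 * O.2 = 0 ∧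
    l * L.1 = a ^ 2 * L.1 ∧ l * L.2 = b ^ 2 * L.2

/-- The cleared equation is the characteristic equation of the symmetric matrix in `IsEigenangle`:
the confocal parameters of `O` are its eigenvalues. -/
theorem onConfocalConic_iff {l : ℝ} (h1 : l ≠ a ^ 2) (h2 : l ≠ b ^ 2) :
    OnConfocalConic a b l O ↔
      (a ^ 2 - l) * (b ^ 2 - l) - O.1 ^ 2 * (b ^ 2 - l) - O.2 ^ 2 * (a ^ 2 - l) = 0 := by
  have h1' : a ^ 2 - l ≠ 0 := sub_ne_zero.2 h1.symm
  have h2' : b ^ 2 - l ≠ 0 := sub_ne_zero.2 h2.symm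
  rw [OnConfocalConic, div_add_div _ _ h1' h2', div_eq_one_iff_eq (mul_ne_zero h1' h2')]
  constructor <;> intro h <;> linarith

/-- The foci are exactly the points where the quadratic form of the pencil has no preferred
directions. -/
theorem quadratic_ne_scalar (hb : 0 < b) (hab : b ≤ a) (hfocus : ¬ IsFocus a b O) :
    ¬ (a ^ 2 - O.1 ^ 2 = b ^ 2 - O.2 ^ 2 ∧ O.1 * O.2 = 0) := by
  rintro ⟨h1, h2⟩
  have h3 : b ^ 2 ≤ a ^ 2 := by nlinarith
  rcases mul_eq_zero.1 h2 with h | h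
  · have h4 : O.2 ^ 2 = 0 := by rw [h] at h1; nlinarith [sq_nonneg O.2]
    have h5 : O.2 = 0 := by simpa using h4
    refine hfocus ⟨?_, h5⟩
    rw [h5] at h1
    linarith
  · refine hfocus ⟨?_, h⟩
    rw [h] at h1
    linarith

theorem lineOf_pencil (O : ℝ × ℝ) (t : ℝ) : lineOf (pencil O t) =
    ![Real.sin t, -Real.cos t, O.2 * Real.cos t - O.1 * Real.sin t] := rfl

/-- The direction of angle `t` is an eigenvector, with eigenvalue `l`, of the quadratic form
that gives the parameter of the confocal conic tangent to a line through `O`. -/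
def IsEigenangle (a b : ℝ) (O : ℝ × ℝ) (l t : ℝ) : Prop :=
  (b ^ 2 - l - O.2 ^ 2) * Real.cos t + O.1 * O.2 * Real.sin t = 0 ∧
  O.1 * O.2 * Real.cos t + (a ^ 2 - l - O.1 ^ 2) * Real.sin t = 0

/-- The equation of the dual conic. The contact point is the pole of `u`, obtained from the inverse
of the diagonal matrix. -/
theorem conic_tangent_iff {l : ℝ} (h1 : l ≠ a ^ 2) (h2 : l ≠ b ^ 2) {u : Fin 3 → ℝ} (hu : u ≠ 0) :
    (∃ P, IsTangentAt (confocalConic a b l) u P) ↔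
      (a ^ 2 - l) * u 0 ^ 2 + (b ^ 2 - l) * u 1 ^ 2 - u 2 ^ 2 = 0 := by
  have h1' : a ^ 2 - l ≠ 0 := sub_ne_zero.2 h1.symm
  have h2' : b ^ 2 - l ≠ 0 := sub_ne_zero.2 h2.symm
  constructor
  · rintro ⟨P, -, hP, k, -, rfl⟩
    simp only [Matrix.mulVec_diagonal, dotProduct, Fin.sum_univ_three, Matrix.cons_val_zero,
      Matrix.cons_val_one, Matrix.cons_val, Pi.smul_apply, smul_eq_mul] at hP ⊢
    field_simp at hP ⊢
    linear_combination k ^ 2 * hP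
  · intro h
    have hQ : Matrix.diagonal ![1 / (a ^ 2 - l), 1 / (b ^ 2 - l), -1] *ᵥ
        ![(a ^ 2 - l) * u 0, (b ^ 2 - l) * u 1, -u 2] = u := by
      ext i
      fin_cases i <;> simp [Matrix.mulVec_diagonal, h1', h2']
    refine ⟨![(a ^ 2 - l) * u 0, (b ^ 2 - l) * u 1, -u 2], ?_, ?_, 1, one_ne_zero, ?_⟩
    · rintro h0
      rw [h0, Matrix.mulVec_zero] at hQ
      exact hu hQ.symm
    · rw [hQ]
      simp only [dotProduct, Fin.sum_univ_three, Matrix.cons_val_zero, Matrix.cons_val_one,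
        Matrix.cons_val]
      linear_combination h
    · rw [hQ, one_smul]

theorem lineOf_pencil_ne_zero (O : ℝ × ℝ) (t : ℝ) : lineOf (pencil O t) ≠ 0 := by
  intro h
  have h0 := congrFun h 0
  have h1 := congrFun h 1
  simp [lineOf_pencil] at h0 h1
  have := Real.cos_sq_add_sin_sq t
  rw [h0, h1] at this
  norm_num at this

/-- A singular binary quadratic form is semidefinite, so its isotropic vectors are its kernel. -/
theorem eigenangle_iff_of_det {A B D c s : ℝ} (hdet : A * D = B ^ 2) :
    (A * c + B * s = 0 ∧ B * c + D * s = 0) ↔ A * c ^ 2 + 2 * B * c * s + D * s ^ 2 = 0 := by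
  constructor
  · rintro ⟨h1, h2⟩
    linear_combination c * h1 + s * h2
  · intro h
    constructor
    · apply pow_eq_zero_iff (two_ne_zero) |>.1
      linear_combination A * h - s ^ 2 * hdet
    · apply pow_eq_zero_iff (two_ne_zero) |>.1
      linear_combination D * h - c ^ 2 * hdet

theorem exists_orthogonal_of_det {A B D : ℝ} (hdet : A * D = B ^ 2) (h0 : ¬ (D = A ∧ B = 0)) :
    ∃ e : ℝ × ℝ, e ≠ 0 ∧ ∀ c s, (A * c + B * s = 0 ∧ B * c + D * s = 0) ↔
      e.1 * c + e.2 * s = 0 := by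
  by_cases hA : A = 0
  · have hB : B = 0 := by rw [hA] at hdet; simpa using hdet.symm
    have hD : D ≠ 0 := fun hD => h0 ⟨by rw [hA, hD], hB⟩
    refine ⟨(0, D), fun h => hD (congrArg Prod.snd h), fun c s => ?_⟩
    simp [hA, hB]
  · refine ⟨(A, B), fun h => hA (congrArg Prod.fst h), fun c s => ⟨fun h => h.1, fun h => ⟨h, ?_⟩⟩⟩
    dsimp only at h
    apply mul_left_cancel₀ hA
    linear_combination B * h + s * hdet

theorem exists_smul_of_orthogonal {L : ℝ × ℝ} (hL : L ≠ 0) {c s : ℝ} (h : L.1 * c + L.2 * s = 0) :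
    ∃ k : ℝ, s = k * L.1 ∧ -c = k * L.2 := by
  have hL0 : L.1 ^ 2 + L.2 ^ 2 ≠ 0 := fun h => hL (Prod.ext
    (by have : L.1 ^ 2 = 0 := by nlinarith [sq_nonneg L.1, sq_nonneg L.2]
        simpa using this)
    (by have : L.2 ^ 2 = 0 := by nlinarith [sq_nonneg L.1, sq_nonneg L.2]
        simpa using this))
  refine ⟨(L.1 * s - L.2 * c) / (L.1 ^ 2 + L.2 ^ 2), ?_, ?_⟩
  · field_simp
    linear_combination L.2 * h
  · field_simp
    linear_combination (-L.1) * h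

/-- The tangent rays are those in the two opposite directions of an eigenvector. -/
theorem IsConfocalThrough.exists_orthogonal (hfocus : ¬ (a ^ 2 - O.1 ^ 2 = b ^ 2 - O.2 ^ 2 ∧ O.1 * O.2 = 0))
    {K : Curve} {l : ℝ} (hK : IsConfocalThrough a b O K l) :
    ∃ e : ℝ × ℝ, e ≠ 0 ∧ ∀ t, ((∃ P, IsTangentAt K (lineOf (pencil O t)) P) ↔
      e.1 * Real.cos t + e.2 * Real.sin t = 0) ∧
      (e.1 * Real.cos t + e.2 * Real.sin t = 0 → IsEigenangle a b O l t) := by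
  rcases hK with ⟨rfl, h1, h2, h3⟩ | ⟨L, rfl, hL, hLO, hl1, hl2⟩
  · rw [onConfocalConic_iff h1 h2] at h3
    have hdet : (b ^ 2 - l - O.2 ^ 2) * (a ^ 2 - l - O.1 ^ 2) = (O.1 * O.2) ^ 2 := by
      linear_combination h3
    obtain ⟨e, he, hes⟩ := exists_orthogonal_of_det hdet
      fun h => hfocus ⟨by linarith [h.1], h.2⟩
    refine ⟨e, he, fun t => ⟨?_, (hes _ _).2⟩⟩
    rw [conic_tangent_iff h1 h2 (lineOf_pencil_ne_zero O t), ← hes, eigenangle_iff_of_det hdet,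
      lineOf_pencil]
    simp only [Matrix.cons_val_zero, Matrix.cons_val_one, Matrix.cons_val]
    constructor <;> intro h <;> linear_combination h
  · refine ⟨L, hL, fun t => ?_⟩
    refine ⟨⟨?_, fun h => ?_⟩, fun h => ?_⟩
    · rintro ⟨P, -, -, k, hk, h⟩
      have h0 := congrFun h 0
      have h1 := congrFun h 1
      simp [lineOf_pencil] at h0 h1
      rw [h0]
      linear_combination (-L.1) * h1
    · obtain ⟨k, e0, e1⟩ := exists_smul_of_orthogonal hL h
      refine ⟨![O.1, O.2, 1], fun h => by simpa using congrFun h 2, ?_, k, ?_, ?_⟩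
      · simp [dotProduct, Fin.sum_univ_three]
        linarith
      · rintro rfl
        have := Real.cos_sq_add_sin_sq t
        rw [e0, neg_eq_iff_eq_neg.1 e1] at this
        norm_num at this
      · rw [lineOf_pencil]
        ext i
        fin_cases i
        · simpa using e0
        · simpa using e1
        · simp
          linear_combination (-O.1) * e0 - O.2 * e1 - k * hLO
    · obtain ⟨k, e0, e1⟩ := exists_smul_of_orthogonal hL h
      constructor
      · linear_combination (O.1 * O.2) * e0 - (b ^ 2 - l - O.2 ^ 2) * e1 + k * O.2 * hLO + k * hl2
      · linear_combination (a ^ 2 - l - O.1 ^ 2) * e0 - (O.1 * O.2) * e1 - k * O.1 * hLO - k * hl1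

/-! ### The curves playing the roles of the confocal ellipse and hyperbola -/

/-- Two distinct roots are all the roots of the quadratic, so `(b² - l) (b² - l')` is its value at
`b²`, which is not positive. Each side of `b²` thus carries at most one root. -/
theorem confocal_root_unique (hab : b ^ 2 ≤ a ^ 2) {l l' : ℝ} (hpos : 0 < (b ^ 2 - l) * (b ^ 2 - l'))
    (hl : (a ^ 2 - l) * (b ^ 2 - l) - O.1 ^ 2 * (b ^ 2 - l) - O.2 ^ 2 * (a ^ 2 - l) = 0)
    (hl' : (a ^ 2 - l') * (b ^ 2 - l') - O.1 ^ 2 * (b ^ 2 - l') - O.2 ^ 2 * (a ^ 2 - l') = 0) :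
    l' = l := by
  by_contra hne
  have h1 : (l' - l) * ((l' + l) - (a ^ 2 + b ^ 2 - O.1 ^ 2 - O.2 ^ 2)) = 0 := by
    linear_combination hl' - hl
  have h2 := (mul_eq_zero.1 h1).resolve_left (sub_ne_zero.2 hne)
  have h3 : (b ^ 2 - l) * (b ^ 2 - l') = -(O.2 ^ 2 * (a ^ 2 - b ^ 2)) := by
    linear_combination (-1) * hl + (l - b ^ 2) * h2
  have h5 : 0 ≤ O.2 ^ 2 * (a ^ 2 - b ^ 2) := mul_nonneg (sq_nonneg _) (by linarith)
  linarith

theorem exists_ellipse (ha : 0 < a) (hb : 0 < b) (hab : b ≤ a) (hO : form a b O O < 1)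
    (hfocus : ¬ IsFocus a b O) : ∃ E l, (∀ K, IsEllipseThrough a b O K ↔ K = E) ∧
      IsConfocalThrough a b O E l ∧ (l < b ^ 2 ∨ l = b ^ 2 ∧ O.1 ^ 2 < a ^ 2 - b ^ 2) := by
  have hab2 : b ^ 2 ≤ a ^ 2 := by nlinarith
  by_cases hax : O.2 = 0 ∧ O.1 ^ 2 < a ^ 2 - b ^ 2
  · refine ⟨.line ![0, 1, 0], b ^ 2, fun K => ⟨?_, fun h => Or.inr ⟨hax.1, hax.2, h⟩⟩,
      Or.inr ⟨(0, 1), rfl, by simp, by simp [hax.1], by simp, rfl⟩, Or.inr ⟨rfl, hax.2⟩⟩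
    rintro (⟨l, hl, h, -⟩ | ⟨-, -, h⟩)
    · rw [onConfocalConic_iff (by linarith) hl.ne, hax.1] at h
      have h1 : (b ^ 2 - l) * (a ^ 2 - l - O.1 ^ 2) = 0 := by linear_combination h
      rcases mul_eq_zero.1 h1 with h2 | h2 <;> linarith [hax.2]
    · exact h
  · have hex : ∃ l, l < b ^ 2 ∧
        (a ^ 2 - l) * (b ^ 2 - l) - O.1 ^ 2 * (b ^ 2 - l) - O.2 ^ 2 * (a ^ 2 - l) = 0 := by
      by_cases hy : O.2 = 0
      · refine ⟨a ^ 2 - O.1 ^ 2, ?_, by rw [hy]; ring⟩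
        have h1 : ¬ O.1 ^ 2 < a ^ 2 - b ^ 2 := fun h => hax ⟨hy, h⟩
        have h2 : O.1 ^ 2 ≠ a ^ 2 - b ^ 2 := fun h => hfocus ⟨h, hy⟩
        have := lt_of_le_of_ne (not_lt.1 h1) h2.symm
        linarith
      · have hy2 : 0 < O.2 ^ 2 := by positivity
        rcases hab.eq_or_lt with rfl | hlt
        · exact ⟨b ^ 2 - O.1 ^ 2 - O.2 ^ 2, by nlinarith [sq_nonneg O.1], by ring⟩
        · have hlt2 : b ^ 2 < a ^ 2 := by nlinarith
          have hc : ContinuousOn (fun l : ℝ => (a ^ 2 - l) * (b ^ 2 - l) - O.1 ^ 2 * (b ^ 2 - l)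
              - O.2 ^ 2 * (a ^ 2 - l)) (Set.Icc 0 (b ^ 2)) := by fun_prop
          have h0 : 0 < a ^ 2 * b ^ 2 - O.1 ^ 2 * b ^ 2 - O.2 ^ 2 * a ^ 2 := by
            have h1 : form a b O O * (a ^ 2 * b ^ 2) = O.1 ^ 2 * b ^ 2 + O.2 ^ 2 * a ^ 2 := by
              unfold form
              field_simp
            have h2 : 0 < a ^ 2 * b ^ 2 := by positivity
            nlinarith
          have h1 : O.2 ^ 2 * (a ^ 2 - b ^ 2) > 0 := mul_pos hy2 (by linarith)
          -- The quadratic is positive at `0`, because `O` is inside `C`, and negative at `b²`.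
          obtain ⟨l, hl, hl0⟩ := intermediate_value_Ioo' (sq_nonneg b) hc
            (show (0 : ℝ) ∈ _ from ⟨by simp; nlinarith, by simp; nlinarith⟩)
          exact ⟨l, hl.2, hl0⟩
    obtain ⟨l, hl, hl0⟩ := hex
    have hla : l ≠ a ^ 2 := by linarith
    refine ⟨confocalConic a b l, l, fun K => ⟨?_, fun h => Or.inl
      ⟨l, hl, (onConfocalConic_iff hla hl.ne).2 hl0, h⟩⟩,
      Or.inl ⟨rfl, hla, hl.ne, (onConfocalConic_iff hla hl.ne).2 hl0⟩, Or.inl hl⟩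
    rintro (⟨l', hl', h, rfl⟩ | ⟨h1, h2, -⟩)
    · rw [onConfocalConic_iff (by linarith) hl'.ne] at h
      have : l' = l := confocal_root_unique hab2 (mul_pos (by linarith) (by linarith)) hl0 h
      rw [this]
    · exact absurd ⟨h1, h2⟩ hax

theorem exists_hyperbola (hb : 0 < b) (hab : b ≤ a)
    (hfocus : ¬ IsFocus a b O) : ∃ H l, (∀ K, IsHyperbolaThrough a b O K ↔ K = H) ∧
      IsConfocalThrough a b O H l ∧ (b ^ 2 < l ∨ l = b ^ 2 ∧ a ^ 2 - b ^ 2 ≤ O.1 ^ 2) := by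
  rcases hab.eq_or_lt with rfl | hlt
  · refine ⟨.line ![O.2, -O.1, 0], b ^ 2, fun K => ⟨?_, fun h => Or.inr (Or.inr (Or.inr ⟨rfl, h⟩))⟩,
      Or.inr ⟨(O.2, -O.1), rfl, ?_, by ring, rfl, rfl⟩, Or.inr ⟨rfl, by nlinarith [sq_nonneg O.1]⟩⟩
    · rintro (⟨l, h1, h2, -⟩ | ⟨h, -⟩ | ⟨h, -⟩ | ⟨-, h⟩)
      · linarith
      · exact absurd h (lt_irrefl _)
      · exact absurd h (lt_irrefl _)
      · exact h
    · intro h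
      have h1 : O.2 = 0 := congrArg Prod.fst h
      have h2 : -O.1 = 0 := congrArg Prod.snd h
      exact hfocus ⟨by rw [neg_eq_zero.1 h2]; ring, h1⟩
  have hlt2 : b ^ 2 < a ^ 2 := by nlinarith
  by_cases hx : O.1 = 0
  · refine ⟨.line ![1, 0, 0], a ^ 2, fun K => ⟨?_, fun h => Or.inr (Or.inl ⟨hlt, hx, h⟩)⟩,
      Or.inr ⟨(1, 0), rfl, by simp, by simp [hx], rfl, by simp⟩, Or.inl hlt2⟩
    rintro (⟨l, h1, h2, h3, -⟩ | ⟨-, -, h⟩ | ⟨-, -, h, -⟩ | ⟨h, -⟩)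
    · rw [onConfocalConic_iff h2.ne h1.ne', hx] at h3
      have h4 : (a ^ 2 - l) * (b ^ 2 - l - O.2 ^ 2) = 0 := by linear_combination h3
      rcases mul_eq_zero.1 h4 with h | h <;> nlinarith [sq_nonneg O.2]
    · exact h
    · rw [hx] at h
      nlinarith
    · linarith
  have hx2 : 0 < O.1 ^ 2 := by positivity
  by_cases hax : O.2 = 0 ∧ a ^ 2 - b ^ 2 < O.1 ^ 2
  · refine ⟨.line ![0, 1, 0], b ^ 2, fun K => ⟨?_,
      fun h => Or.inr (Or.inr (Or.inl ⟨hlt, hax.1, hax.2, h⟩))⟩,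
      Or.inr ⟨(0, 1), rfl, by simp, by simp [hax.1], by simp, rfl⟩, Or.inr ⟨rfl, hax.2.le⟩⟩
    rintro (⟨l, h1, h2, h3, -⟩ | ⟨-, h, -⟩ | ⟨-, -, -, h⟩ | ⟨h, -⟩)
    · rw [onConfocalConic_iff h2.ne h1.ne', hax.1] at h3
      have h4 : (b ^ 2 - l) * (a ^ 2 - l - O.1 ^ 2) = 0 := by linear_combination h3
      rcases mul_eq_zero.1 h4 with h | h <;> linarith [hax.2]
    · exact absurd h hx
    · exact h
    · linarith
  have hex : ∃ l, b ^ 2 < l ∧ l < a ^ 2 ∧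
      (a ^ 2 - l) * (b ^ 2 - l) - O.1 ^ 2 * (b ^ 2 - l) - O.2 ^ 2 * (a ^ 2 - l) = 0 := by
    by_cases hy : O.2 = 0
    · refine ⟨a ^ 2 - O.1 ^ 2, ?_, by linarith, by rw [hy]; ring⟩
      have h1 : ¬ a ^ 2 - b ^ 2 < O.1 ^ 2 := fun h => hax ⟨hy, h⟩
      have h2 : O.1 ^ 2 ≠ a ^ 2 - b ^ 2 := fun h => hfocus ⟨h, hy⟩
      have := lt_of_le_of_ne (not_lt.1 h1) h2
      linarith
    · have hy2 : 0 < O.2 ^ 2 := by positivity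
      have hc : ContinuousOn (fun l : ℝ => (a ^ 2 - l) * (b ^ 2 - l) - O.1 ^ 2 * (b ^ 2 - l)
          - O.2 ^ 2 * (a ^ 2 - l)) (Set.Icc (b ^ 2) (a ^ 2)) := by fun_prop
      have h1 : 0 < O.2 ^ 2 * (a ^ 2 - b ^ 2) := mul_pos hy2 (by linarith)
      have h2 : 0 < O.1 ^ 2 * (a ^ 2 - b ^ 2) := mul_pos hx2 (by linarith)
      -- The quadratic is negative at `b²` and positive at `a²`, as `O` lies on neither axis.
      obtain ⟨l, hl, hl0⟩ := intermediate_value_Ioo hlt2.le hc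
        (show (0 : ℝ) ∈ _ from ⟨by simp; nlinarith, by simp; nlinarith⟩)
      exact ⟨l, hl.1, hl.2, hl0⟩
  obtain ⟨l, hl, hla, hl0⟩ := hex
  have hon := (onConfocalConic_iff hla.ne hl.ne').2 hl0
  refine ⟨confocalConic a b l, l, fun K => ⟨?_, fun h => Or.inl ⟨l, hl, hla, hon, h⟩⟩,
    Or.inl ⟨rfl, hla.ne, hl.ne', hon⟩, Or.inl hl⟩
  rintro (⟨l', hl', hla', h, rfl⟩ | ⟨-, h, -⟩ | ⟨-, h1, h2, -⟩ | ⟨h, -⟩)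
  · rw [onConfocalConic_iff hla'.ne hl'.ne'] at h
    have : l' = l :=
      confocal_root_unique hlt2.le (mul_pos_of_neg_of_neg (by linarith) (by linarith)) hl0 h
    rw [this]
  · exact absurd h hx
  · exact absurd ⟨h1, h2⟩ hax
  · linarith

/-! ### The conserved quantity along the pencil -/

theorem sq_mul_disc_pencil (ha : a ≠ 0) (hb : b ≠ 0) (t : ℝ) :
    a ^ 2 * b ^ 2 * disc a b (pencil O t) = (b ^ 2 - O.2 ^ 2) * Real.cos t ^ 2
      + 2 * (O.1 * O.2) * Real.cos t * Real.sin t + (a ^ 2 - O.1 ^ 2) * Real.sin t ^ 2 := by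
  rw [sq_mul_disc ha hb]
  simp only [pencil, support]
  ring

theorem deriv_disc_pencil (ha : a ≠ 0) (hb : b ≠ 0) : deriv (fun t => disc a b (pencil O t)) =
    fun t => (2 * (a ^ 2 - O.1 ^ 2 - (b ^ 2 - O.2 ^ 2)) * (Real.cos t * Real.sin t)
      + 2 * (O.1 * O.2) * (Real.cos t ^ 2 - Real.sin t ^ 2)) / (a ^ 2 * b ^ 2) := by
  have h : (fun t => disc a b (pencil O t)) = fun t => ((b ^ 2 - O.2 ^ 2) * Real.cos t ^ 2
      + 2 * (O.1 * O.2) * (Real.cos t * Real.sin t) + (a ^ 2 - O.1 ^ 2) * Real.sin t ^ 2)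
      / (a ^ 2 * b ^ 2) := funext fun t => by
    rw [eq_div_iff (by positivity), mul_comm, sq_mul_disc_pencil ha hb]
    ring
  rw [h]
  funext t
  have hc := Real.hasDerivAt_cos t
  have hs := Real.hasDerivAt_sin t
  refine (((((hc.pow 2).const_mul _).add ((hc.mul hs).const_mul _)).add
    ((hs.pow 2).const_mul _)).div_const _).deriv.trans ?_
  norm_num
  ring

theorem deriv_deriv_disc_pencil (ha : a ≠ 0) (hb : b ≠ 0) (t : ℝ) :
    deriv (deriv (fun t => disc a b (pencil O t))) t =
    (2 * (a ^ 2 - O.1 ^ 2 - (b ^ 2 - O.2 ^ 2)) * (Real.cos t ^ 2 - Real.sin t ^ 2)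
      - 8 * (O.1 * O.2) * (Real.cos t * Real.sin t)) / (a ^ 2 * b ^ 2) := by
  rw [deriv_disc_pencil ha hb]
  have hc := Real.hasDerivAt_cos t
  have hs := Real.hasDerivAt_sin t
  refine ((((hc.mul hs).const_mul _).add (((hc.pow 2).sub (hs.pow 2)).const_mul _)).div_const
    _).deriv.trans ?_
  norm_num
  ring

theorem IsEigenangle.disc_eq (ha : a ≠ 0) (hb : b ≠ 0) {l t : ℝ} (h : IsEigenangle a b O l t) :
    a ^ 2 * b ^ 2 * disc a b (pencil O t) = l := by
  rw [sq_mul_disc_pencil ha hb]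
  linear_combination Real.cos t * h.1 + Real.sin t * h.2 + l * Real.cos_sq_add_sin_sq t

theorem IsEigenangle.deriv_disc (ha : a ≠ 0) (hb : b ≠ 0) {l t : ℝ} (h : IsEigenangle a b O l t) :
    deriv (fun t => disc a b (pencil O t)) t = 0 := by
  rw [deriv_disc_pencil ha hb]
  refine div_eq_zero_iff.2 (Or.inl ?_)
  linear_combination 2 * Real.cos t * h.2 - 2 * Real.sin t * h.1

/-- Up to a constant the form is a combination of `cos 2θ` and `sin 2θ`. If its first two
derivatives vanish at one angle, both coefficients vanish and the form is scalar. -/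
theorem IsEigenangle.deriv_deriv_disc (ha : a ≠ 0) (hb : b ≠ 0)
    (hfocus : ¬ (a ^ 2 - O.1 ^ 2 = b ^ 2 - O.2 ^ 2 ∧ O.1 * O.2 = 0)) {l t : ℝ}
    (h : IsEigenangle a b O l t) : deriv (deriv (fun t => disc a b (pencil O t))) t ≠ 0 := by
  rw [deriv_deriv_disc_pencil ha hb]
  refine div_ne_zero (fun h2 => hfocus ?_) (by positivity)
  have h1 : (a ^ 2 - O.1 ^ 2 - (b ^ 2 - O.2 ^ 2)) * (Real.cos t * Real.sin t)
      + O.1 * O.2 * (Real.cos t ^ 2 - Real.sin t ^ 2) = 0 := by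
    linear_combination Real.cos t * h.2 - Real.sin t * h.1
  have h3 := Real.cos_sq_add_sin_sq t
  have h4 : (Real.cos t ^ 2 - Real.sin t ^ 2) ^ 2 + 4 * (Real.cos t * Real.sin t) ^ 2 = 1 := by
    linear_combination (Real.cos t ^ 2 + Real.sin t ^ 2 + 1) * h3
  constructor
  · linear_combination (Real.cos t ^ 2 - Real.sin t ^ 2) / 2 * h2
      + 4 * (Real.cos t * Real.sin t) * h1
      - (a ^ 2 - O.1 ^ 2 - (b ^ 2 - O.2 ^ 2)) * h4
  · linear_combination (Real.cos t ^ 2 - Real.sin t ^ 2) * h1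
      - (Real.cos t * Real.sin t) / 2 * h2 - O.1 * O.2 * h4

/-! ### Tangency of the reflected lines -/

theorem eq_smul_cross {u l m : Fin 3 → ℝ} (hl : u ⬝ᵥ l = 0) (hm : u ⬝ᵥ m = 0)
    (h : crossProduct l m ≠ 0) : ∃ k : ℝ, u = k • crossProduct l m := by
  have hn : crossProduct l m ⬝ᵥ crossProduct l m ≠ 0 := fun h0 => h (dotProduct_self_eq_zero.1 h0)
  refine ⟨(u ⬝ᵥ crossProduct l m) / (crossProduct l m ⬝ᵥ crossProduct l m), ?_⟩
  rw [div_eq_inv_mul, mul_smul, eq_inv_smul_iff₀ hn]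
  simp only [cross_apply, dotProduct, Fin.sum_univ_three, Matrix.cons_val_zero,
    Matrix.cons_val_one, Matrix.cons_val] at hl hm ⊢
  ext i
  fin_cases i
  · simp
    linear_combination
      ((l 2 * m 0 - l 0 * m 2) * l 2 - (l 0 * m 1 - l 1 * m 0) * l 1) * hm
      - ((l 2 * m 0 - l 0 * m 2) * m 2 - (l 0 * m 1 - l 1 * m 0) * m 1) * hl
  · simp
    linear_combination
      ((l 0 * m 1 - l 1 * m 0) * l 0 - (l 1 * m 2 - l 2 * m 1) * l 2) * hm
      - ((l 0 * m 1 - l 1 * m 0) * m 0 - (l 1 * m 2 - l 2 * m 1) * m 2) * hl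
  · simp
    linear_combination
      ((l 1 * m 2 - l 2 * m 1) * l 1 - (l 2 * m 0 - l 0 * m 2) * l 0) * hm
      - ((l 1 * m 2 - l 2 * m 1) * m 1 - (l 2 * m 0 - l 0 * m 2) * m 0) * hl

theorem isTangentAt_conic (ha : a ≠ 0) (hb : b ≠ 0) (hO : form a b O O < 1) (n : ℕ) {l t : ℝ}
    (hla : l ≠ a ^ 2) (hlb : l ≠ b ^ 2) (h : IsEigenangle a b O l t) :
    IsTangentAt (confocalConic a b l) (reflectedLine a b O n t) (caustic a b O n t) := by
  have hc := contDiff_rayCos ha hb hO n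
  have hs := contDiff_raySin ha hb hO n
  have hw := contDiff_raySupport ha hb hO n
  have hun := rayCos_sq_add ha hb hO n
  have hα : a ^ 2 - l ≠ 0 := sub_ne_zero.2 hla.symm
  have hβ : b ^ 2 - l ≠ 0 := sub_ne_zero.2 hlb.symm
  have hF : ∀ t, a ^ 2 * raySin a b O n t ^ 2 + b ^ 2 * rayCos a b O n t ^ 2
      - raySupport a b O n t ^ 2 = a ^ 2 * b ^ 2 * disc a b (pencil O t) := fun t => by
    rw [← disc_ray ha hb hO n t, sq_mul_disc ha hb]
    rfl
  have hF0 := hF t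
  rw [h.disc_eq ha hb] at hF0
  have hd : ContDiff ℝ ω (fun t => disc a b (pencil O t)) :=
    contDiff_disc (contDiff_ray ha hb hO 0)
  have e1 := (((((hs.hasDerivAt_omega t).pow 2).const_mul (a ^ 2)).add
    (((hc.hasDerivAt_omega t).pow 2).const_mul (b ^ 2))).sub ((hw.hasDerivAt_omega t).pow 2))
  have e2 := (hd.hasDerivAt_omega t).const_mul (a ^ 2 * b ^ 2)
  rw [← funext hF, h.deriv_disc ha hb] at e2
  have e3 := e1.unique e2
  norm_num at e3
  have e4 := ((hc.hasDerivAt_omega t).pow 2).add ((hs.hasDerivAt_omega t).pow 2)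
  have e5 : rayCos a b O n ^ 2 + raySin a b O n ^ 2 = fun _ => (1 : ℝ) := funext hun
  rw [e5] at e4
  have e6 := e4.unique (hasDerivAt_const t (1 : ℝ))
  norm_num at e6
  have hline : reflectedLine a b O n t
      = ![raySin a b O n t, -rayCos a b O n t, raySupport a b O n t] := rfl
  have hline' : deriv (reflectedLine a b O n) t = ![deriv (raySin a b O n) t,
      -deriv (rayCos a b O n) t, deriv (raySupport a b O n) t] :=
    (hasDerivAt_line (hc.hasDerivAt_omega t) (hs.hasDerivAt_omega t)
      (hw.hasDerivAt_omega t)).deriv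
  have hne := caustic_ne_zero ha hb hO n t
  -- `u` is the pole of the reflected line. It lies on that line because the dual equation holds,
  -- and on the derivative line because the derivative of `disc` vanishes.
  set u : Fin 3 → ℝ := ![(a ^ 2 - l) * raySin a b O n t, (b ^ 2 - l) * -rayCos a b O n t,
    -raySupport a b O n t] with hu
  have hul : u ⬝ᵥ reflectedLine a b O n t = 0 := by
    rw [hline, hu]
    simp only [dotProduct, Fin.sum_univ_three, Matrix.cons_val_zero, Matrix.cons_val_one,
      Matrix.cons_val]
    linear_combination hF0 - l * hun t
  have hum : u ⬝ᵥ deriv (reflectedLine a b O n) t = 0 := by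
    rw [hline', hu]
    simp only [dotProduct, Fin.sum_univ_three, Matrix.cons_val_zero, Matrix.cons_val_one,
      Matrix.cons_val]
    linear_combination e3 / 2 - l / 2 * e6
  obtain ⟨k, hk⟩ := eq_smul_cross hul hum hne
  have hQ : Matrix.diagonal ![1 / (a ^ 2 - l), 1 / (b ^ 2 - l), -1] *ᵥ u
      = reflectedLine a b O n t := by
    rw [hline, hu]
    ext i
    fin_cases i <;> simp [Matrix.mulVec_diagonal, hα, hβ]
  have hl0 : reflectedLine a b O n t ≠ 0 := fun h0 => hne (by
    rw [caustic, h0, map_zero, LinearMap.zero_apply])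
  have hk0 : k ≠ 0 := by
    rintro rfl
    rw [hk, zero_smul, Matrix.mulVec_zero] at hQ
    exact hl0 hQ.symm
  have hkQ : reflectedLine a b O n t
      = k • (Matrix.diagonal ![1 / (a ^ 2 - l), 1 / (b ^ 2 - l), -1] *ᵥ caustic a b O n t) := by
    rw [← hQ, hk, Matrix.mulVec_smul]
    rfl
  refine ⟨hne, ?_, k, hk0, hkQ⟩
  have h7 : caustic a b O n t ⬝ᵥ reflectedLine a b O n t = 0 := by
    rw [dotProduct_comm, caustic, dot_self_cross]
  rw [hkQ, dotProduct_smul, smul_eq_mul] at h7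
  exact (mul_eq_zero.1 h7).resolve_left hk0

/-- The rays carried by an axis remain on it. -/
theorem ray_mem_axis {L : ℝ × ℝ} (hL : ∀ X : ℝ × ℝ, L.1 * X.1 + L.2 * X.2 = 0 →
      L.1 * (normal a b X).1 + L.2 * (normal a b X).2 = 0)
    (hLO : L.1 * O.1 + L.2 * O.2 = 0) {t : ℝ} (ht : L.1 * Real.cos t + L.2 * Real.sin t = 0)
    (n : ℕ) : L.1 * (ray a b O n t).1.1 + L.2 * (ray a b O n t).1.2 = 0 ∧
      L.1 * (ray a b O n t).2.1 + L.2 * (ray a b O n t).2.2 = 0 := by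
  induction n with
  | zero => exact ⟨hLO, ht⟩
  | succ n ih =>
    obtain ⟨h1, h2⟩ := ih
    have hX : L.1 * (exitPoint a b (ray a b O n t)).1 + L.2 * (exitPoint a b (ray a b O n t)).2
        = 0 := by
      simp only [exitPoint, Prod.fst_add, Prod.snd_add, Prod.smul_fst, Prod.smul_snd, smul_eq_mul]
      linear_combination h1 + exitTime a b (ray a b O n t) * h2
    rw [ray_succ]
    refine ⟨hX, ?_⟩
    have hN := hL _ hX
    simp only [bounce, mirror, Prod.fst_sub, Prod.snd_sub, Prod.smul_fst, Prod.smul_snd,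
      smul_eq_mul]
    generalize 2 * ((ray a b O n t).2.1 * (normal a b (exitPoint a b (ray a b O n t))).1 +
      (ray a b O n t).2.2 * (normal a b (exitPoint a b (ray a b O n t))).2) / _ = k
    linear_combination h2 - k * hN

theorem isTangentAt_axis (ha : a ≠ 0) (hb : b ≠ 0) (hO : form a b O O < 1) (n : ℕ) {l t : ℝ}
    {L : ℝ × ℝ} (hL0 : L ≠ 0) (hLO : L.1 * O.1 + L.2 * O.2 = 0) (hl1 : l * L.1 = a ^ 2 * L.1)
    (hl2 : l * L.2 = b ^ 2 * L.2) (ht : L.1 * Real.cos t + L.2 * Real.sin t = 0) :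
    IsTangentAt (.line ![L.1, L.2, 0]) (reflectedLine a b O n t) (caustic a b O n t) := by
  have hL : ∀ X : ℝ × ℝ, L.1 * X.1 + L.2 * X.2 = 0 →
      L.1 * (normal a b X).1 + L.2 * (normal a b X).2 = 0 := fun X hX => by
    -- The eigenvector conditions on `L` leave a coordinate axis or, when `a² = b²`, any diameter.
    -- In each case the normal of `C` at a point of the line lies along it.
    have h1 : L.1 * X.1 * b ^ 2 + L.2 * X.2 * a ^ 2 = 0 := by
      by_cases h1 : L.1 = 0
      · rw [h1] at hX ⊢
        linear_combination a ^ 2 * hX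
      by_cases h2 : L.2 = 0
      · rw [h2] at hX ⊢
        linear_combination b ^ 2 * hX
      · have h3 : b ^ 2 = a ^ 2 := by
          rw [← mul_right_cancel₀ h1 hl1, ← mul_right_cancel₀ h2 hl2]
        linear_combination a ^ 2 * hX + L.1 * X.1 * h3
    simp only [normal]
    field_simp
    linear_combination h1
  obtain ⟨h1, h2⟩ := ray_mem_axis hL hLO ht n
  obtain ⟨k, hs, hc⟩ := exists_smul_of_orthogonal hL0 h2
  have hk : reflectedLine a b O n t = k • ![L.1, L.2, 0] := by
    have h3 : reflectedLine a b O n t = ![(ray a b O n t).2.2, -(ray a b O n t).2.1,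
      (ray a b O n t).1.2 * (ray a b O n t).2.1 - (ray a b O n t).1.1 * (ray a b O n t).2.2] := rfl
    rw [h3]
    ext i
    fin_cases i
    · simpa using hs
    · simpa using hc
    · simp
      linear_combination (-(ray a b O n t).1.1) * hs - (ray a b O n t).1.2 * hc - k * h1
  have hne := caustic_ne_zero ha hb hO n t
  have hk0 : k ≠ 0 := by
    rintro rfl
    apply hne
    rw [caustic, hk, zero_smul, map_zero, LinearMap.zero_apply]
  refine ⟨hne, ?_, k, hk0, hk⟩
  have h4 : reflectedLine a b O n t ⬝ᵥ caustic a b O n t = 0 := by rw [caustic, dot_self_cross]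
  rw [hk, smul_dotProduct, smul_eq_mul] at h4
  exact (mul_eq_zero.1 h4).resolve_left hk0

theorem IsConfocalThrough.isTangentAt (ha : a ≠ 0) (hb : b ≠ 0) (hO : form a b O O < 1)
    (hfocus : ¬ (a ^ 2 - O.1 ^ 2 = b ^ 2 - O.2 ^ 2 ∧ O.1 * O.2 = 0)) {K : Curve} {l t : ℝ}
    (hK : IsConfocalThrough a b O K l) (ht : ∃ P, IsTangentAt K (lineOf (pencil O t)) P) (n : ℕ) :
    IsTangentAt K (reflectedLine a b O n t) (caustic a b O n t) := by
  obtain ⟨e, -, he⟩ := hK.exists_orthogonal hfocus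
  have heig := (he t).2 ((he t).1.1 ht)
  rcases hK with ⟨rfl, h1, h2, -⟩ | ⟨L, rfl, hL, hLO, hl1, hl2⟩
  · exact isTangentAt_conic ha hb hO n h1 h2 heig
  · refine isTangentAt_axis ha hb hO n hL hLO hl1 hl2 ?_
    obtain ⟨P, -, -, k, -, hk⟩ := ht
    have h0 := congrFun hk 0
    have h1 := congrFun hk 1
    simp [lineOf_pencil] at h0 h1
    rw [h0]
    linear_combination (-L.1) * h1

end EllipticBilliard
end

theorem theorem1 (a b : ℝ) (hb : 0 < b) (hab : b ≤ a) (O : ℝ × ℝ)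
    (hO : form a b O O < 1) (hfocus : ¬ IsFocus a b O) :
    ∃ E H : Curve,
      (∀ K, IsEllipseThrough a b O K ↔ K = E) ∧
      (∀ K, IsHyperbolaThrough a b O K ↔ K = H) ∧
      (tangentAngles O E).ncard = 2 ∧ (tangentAngles O H).ncard = 2 ∧
      Disjoint (tangentAngles O E) (tangentAngles O H) ∧
      ∀ n : ℕ, 1 ≤ n →
        IsEnvelope (reflectedLine a b O n) (caustic a b O n) ∧
        ∀ K, K = E ∨ K = H → ∀ θ ∈ tangentAngles O K,
          IsTangentAt K (reflectedLine a b O n θ) (caustic a b O n θ) ∧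
          IsCuspAt (caustic a b O n) θ := by
  have ha : 0 < a := hb.trans_le hab
  have hns := quadratic_ne_scalar hb hab hfocus
  obtain ⟨E, lE, hE, hEc, hEl⟩ := exists_ellipse ha hb hab hO hfocus
  obtain ⟨H, lH, hH, hHc, hHl⟩ := exists_hyperbola hb hab hfocus
  obtain ⟨e, he0, he⟩ := hEc.exists_orthogonal hns
  obtain ⟨h, hh0, hh⟩ := hHc.exists_orthogonal hns
  -- Both parameters can equal `b²` only on the axis, where the side conditions on `O.1` exclude
  -- each other. The strict inequality separates the two pairs of rays, since a common ray would
  -- give `disc` two values.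
  have hlt : lE < lH := by
    rcases hEl with hEl | ⟨hEl, hEx⟩ <;> rcases hHl with hHl | ⟨hHl, hHx⟩ <;> linarith
  refine ⟨E, H, hE, hH, ?_, ?_, ?_, fun n hn => ⟨isEnvelope_caustic ha.ne' hb.ne' hO n, ?_⟩⟩
  · simp only [tangentAngles, (he _).1]
    exact ncard_angles_orthogonal he0
  · simp only [tangentAngles, (hh _).1]
    exact ncard_angles_orthogonal hh0
  · rw [Set.disjoint_left]
    rintro t ⟨-, h1⟩ ⟨-, h2⟩
    have h3 := ((he t).2 ((he t).1.1 h1)).disc_eq ha.ne' hb.ne'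
    have h4 := ((hh t).2 ((hh t).1.1 h2)).disc_eq ha.ne' hb.ne'
    linarith
  · have key : ∀ {K l}, IsConfocalThrough a b O K l → ∀ t ∈ tangentAngles O K,
        IsTangentAt K (reflectedLine a b O n t) (caustic a b O n t) ∧
        IsCuspAt (caustic a b O n) t := by
      rintro K l hK t ⟨-, ht⟩
      obtain ⟨f, -, hf⟩ := hK.exists_orthogonal hns
      have heig := (hf t).2 ((hf t).1.1 ht)
      exact ⟨hK.isTangentAt ha.ne' hb.ne' hO hns ht n, isCuspAt_caustic ha.ne' hb.ne' hO n hn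
        (heig.deriv_disc ha.ne' hb.ne') (heig.deriv_deriv_disc ha.ne' hb.ne' hns)⟩
    rintro K (rfl | rfl)
    · exact key hEc
    · exact key hHc
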